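/- Let $V$ be a Euclidean space of finite dimension $m$ with orthonormal basis $e_1,\dots,e_m$ and Lebesgue measure $dy$. Let $R\subset V$ be a root system, i.e. a finite set of nonzero vectors with $\sigma_\alpha(R)=R$ for all $\alpha\in R$, where $\sigma_\alpha(x)=x-2\frac{\langle\alpha,x\rangle}{\langle\alpha,\alpha\rangle}\alpha$. Let $S\subseteq R$ be a simple system (a basis of $\operatorname{span}(R)$ such that every root is a linear combination of $S$ with coefficients all $\ge 0$ or all $\le 0$), $R_+$ the set of roots that are combinations of $S$ with coefficients $\ge 0$, $C=\{x\in V:\langle\alpha,x\rangle>0\ \forall\alpha\in R_+\}$ the positive Weyl chamber, $W$ the (finite) group generated by the $\sigma_\alpha$, $\alpha\in R$, and $k:R\to[0,\infty)$ a multiplicity function, i.e. constant on $W$-orbits. For $\xi\in V$ let $$T_\xi f(x)=\partial_\xi f(x)+\sum_{\alpha\in R_+}k(\alpha)\langle\alpha,\xi\rangle\frac{f(x)-f(\sigma_\alpha x)}{\langle\alpha,x\rangle}$$ be the Dunkl operator, the quotient being extended continuously to $\langle\alpha,x\rangle=0$ by $\frac{2}{\langle\alpha,\alpha\rangle}\partial_\alpha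 f(x)$, and put $T_i=T_{e_i}$, $\Delta_k=\sum_{i=1}^m T_i^2$ and $\mathscr{J}_k=-\Delta_k+\sum_{i=1}^m x_i\partial_i$. For $y\in V$ let $x\mapsto D_k(x,y)$ be the Dunkl kernel, i.e. the unique real-analytic function $f$ on $V$ with $f(0)=1$ and $T_\xi f=\langle\xi,y\rangle f$ for all $\xi\in V$, and let $D_k^W(x,y)=\sum_{w\in W}D_k(x,wy)$ be the generalized Bessel function. Then the function $$g(x)=\int_C e^{-|y|^2/2}D_k^W(x,y)\prod_{\alpha\in R_+}\langle\alpha,y\rangle\,dy,\qquad x\in V,$$ is an eigenfunction of $-\mathscr{J}_k$ with eigenvalue $m+|R_+|$: the integrand is integrable over $C$ for every $x\in V$, $g$ is of class $C^2$ on $V$ and not identically zero, and $$-\mathscr{J}_k\,g(x)=(m+|R_+|)\,g(x)\qquad\text{for all }x\in V.$$ -/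

import Mathlib

open MeasureTheory
open scoped RealInnerProductSpace

noncomputable section

namespace Dunkl

variable {V : Type*} [NormedAddCommGroup V] [InnerProductSpace ℝ V]

/-- The orthogonal reflection `σ_α` with respect to the hyperplane orthogonal to `α`. -/
def rootReflection (α : V) : V ≃ₗᵢ[ℝ] V := (ℝ ∙ α)ᗮ.reflection

theorem rootReflection_apply (α x : V) :
    rootReflection α x = x - (2 * ⟪α, x⟫ / ⟪α, α⟫) • α := by
  rw [rootReflection, Submodule.reflection_orthogonal_apply, Submodule.reflection_singleton_apply,
    real_inner_self_eq_norm_sq, RCLike.ofReal_real_eq_id, id, neg_sub, mul_div_assoc, mul_smul,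
    two_smul, two_smul]

/-- A (finite) root system: finitely many nonzero vectors with `σ_α(R) = R` for all `α ∈ R`.
It is required neither to be reduced, nor to be crystallographic, nor to span `V`. -/
structure IsRootSystem (R : Finset V) : Prop where
  zero_notMem : (0 : V) ∉ R
  image_reflection : ∀ α ∈ R, rootReflection α '' (R : Set V) = (R : Set V)

/-- `v` is a linear combination of elements of `S` with nonnegative coefficients. -/
def IsPositiveCombination (S : Finset V) (v : V) : Prop :=
  ∃ c : V → ℝ, (∀ s ∈ S, 0 ≤ c s) ∧ v = ∑ s ∈ S, c s • s

/-- A simple system of `R`: a subset of `R` that is a basis of `span R` and such that every root is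
a linear combination of it with coefficients all of the same sign. -/
structure IsSimpleSystem (R S : Finset V) : Prop where
  subset : S ⊆ R
  linearIndepOn : LinearIndepOn ℝ id (S : Set V)
  span_eq : Submodule.span ℝ (S : Set V) = Submodule.span ℝ (R : Set V)
  pos_or_neg : ∀ α ∈ R, IsPositiveCombination S α ∨ IsPositiveCombination S (-α)

open Classical in
/-- The positive subsystem `R_+` of `R` determined by the simple system `S`. -/
def positiveRoots (R S : Finset V) : Finset V := {α ∈ R | IsPositiveCombination S α}

/-- The positive Weyl chamber `C` of the positive subsystem `P = R_+`. -/
def weylChamber (P : Finset V) : Set V := {x | ∀ α ∈ P, 0 < ⟪α, x⟫}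

/-- The reflection group `W`, generated by the reflections `σ_α`, `α ∈ R`. -/
def weylGroup (R : Finset V) : Subgroup (V ≃ₗᵢ[ℝ] V) :=
  Subgroup.closure (rootReflection '' (R : Set V))

/-- A nonnegative multiplicity function: `k` is nonnegative on `R` and constant on the orbits of
the action of `W` on `R`. Only the values of `k` on `R` matter. -/
structure IsMultiplicity (R : Finset V) (k : V → ℝ) : Prop where
  nonneg : ∀ α ∈ R, 0 ≤ k α
  invariant : ∀ w ∈ weylGroup R, ∀ α ∈ R, k (w α) = k α

/-- The difference quotient `(f(x) - f(σ_α x)) / ⟨α, x⟩`, extended by continuity to the hyperplane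
`⟨α, x⟩ = 0`, where its value (for `f` of class `C¹`) is `(2 / ⟨α, α⟩) ∂_α f(x)`. -/
def reflectionQuotient (α : V) (f : V → ℝ) (x : V) : ℝ :=
  if ⟪α, x⟫ = 0 then 2 / ⟪α, α⟫ * fderiv ℝ f x α
  else (f x - f (rootReflection α x)) / ⟪α, x⟫

/-- The Dunkl operator in the direction `ξ`, where `P = R_+`:
`T_ξ f(x) = ∂_ξ f(x) + ∑_{α ∈ R_+} k(α) ⟨α, ξ⟩ (f(x) - f(σ_α x)) / ⟨α, x⟩`. -/
def dunklOp (P : Finset V) (k : V → ℝ) (ξ : V) (f : V → ℝ) (x : V) : ℝ :=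
  fderiv ℝ f x ξ + ∑ α ∈ P, k α * ⟪α, ξ⟫ * reflectionQuotient α f x

/-- The defining problem of the Dunkl kernel: `f` is real analytic on `V`, `f(0) = 1`, and
`T_ξ f = ⟨ξ, y⟩ f` for all directions `ξ`. -/
structure IsDunklEigenfunction (P : Finset V) (k : V → ℝ) (y : V) (f : V → ℝ) : Prop where
  analytic : AnalyticOnNhd ℝ f Set.univ
  map_zero : f 0 = 1
  eigen : ∀ ξ x, dunklOp P k ξ f x = ⟪ξ, y⟫ * f x

/-- The Dunkl kernel `D_k(x, y)`: for each `y`, the function `x ↦ D_k(x, y)` is the (unique) real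
analytic solution of `T_ξ f = ⟨ξ, y⟩ f`, `f(0) = 1`. -/
def dunklKernel (P : Finset V) (k : V → ℝ) (x y : V) : ℝ :=
  Classical.epsilon (IsDunklEigenfunction P k y) x

/-- The Dunkl Laplacian `Δ_k = ∑ T_i²`, with `T_i` the Dunkl operator in the direction of the
`i`-th vector of the orthonormal basis `b`. -/
def dunklLaplacian {m : ℕ} (b : OrthonormalBasis (Fin m) ℝ V) (P : Finset V) (k : V → ℝ)
    (f : V → ℝ) (x : V) : ℝ :=
  ∑ i, dunklOp P k (b i) (dunklOp P k (b i) f) x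

/-- The Euler operator `E_1 = ∑ x_i ∂_i` in the coordinates of the orthonormal basis `b`. -/
def eulerOp {m : ℕ} (b : OrthonormalBasis (Fin m) ℝ V) (f : V → ℝ) (x : V) : ℝ :=
  ∑ i, ⟪b i, x⟫ * fderiv ℝ f x (b i)

/-- The operator `J_k = -Δ_k + E_1`. -/
def operatorJ {m : ℕ} (b : OrthonormalBasis (Fin m) ℝ V) (P : Finset V) (k : V → ℝ)
    (f : V → ℝ) (x : V) : ℝ :=
  -dunklLaplacian b P k f x + eulerOp b f x

/-- The generalized Bessel function `D_k^W(x, y) = ∑_{w ∈ W} D_k(x, w y)`. The sum is finite for a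
root system `R`, by `finite_weylGroup` below. -/
def generalizedBessel (R P : Finset V) (k : V → ℝ) (x y : V) : ℝ :=
  ∑ᶠ w : weylGroup R, dunklKernel P k x ((w : V ≃ₗᵢ[ℝ] V) y)

theorem weylGroup_map_mem {R : Finset V} (hR : IsRootSystem R) {w : V ≃ₗᵢ[ℝ] V}
    (hw : w ∈ weylGroup R) : ∀ β ∈ R, w β ∈ R := by
  have hrefl : ∀ α ∈ R, ∀ β ∈ R, rootReflection α β ∈ R := by
    intro α hα β hβ
    have h : rootReflection α β ∈ rootReflection α '' (R : Set V) := ⟨β, hβ, rfl⟩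
    rw [hR.image_reflection α hα] at h
    exact h
  unfold weylGroup at hw
  induction hw using Subgroup.closure_induction_left with
  | one => intro β hβ; simpa using hβ
  | mul_left x hx y _ ih =>
    obtain ⟨α, hα, rfl⟩ := hx
    intro β hβ
    exact hrefl α hα _ (ih β hβ)
  | inv_mul_cancel x hx y _ ih =>
    obtain ⟨α, hα, rfl⟩ := hx
    intro β hβ
    have h : (rootReflection α)⁻¹ = rootReflection α := (ℝ ∙ α)ᗮ.reflection_symm
    rw [h]
    exact hrefl α hα _ (ih β hβ)

theorem weylGroup_fix_orthogonal {R : Finset V} {w : V ≃ₗᵢ[ℝ] V}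
    (hw : w ∈ weylGroup R) {v : V} (hv : ∀ α ∈ R, ⟪α, v⟫ = 0) : w v = v := by
  unfold weylGroup at hw
  induction hw using Subgroup.closure_induction with
  | mem x hx =>
    obtain ⟨α, hα, rfl⟩ := hx
    simp [rootReflection_apply, hv α hα]
  | one => rfl
  | mul x y _ _ hx hy => change x (y v) = v; rw [hy, hx]
  | inv x _ hx => change x.symm v = v; rw [LinearIsometryEquiv.symm_apply_eq, hx]

theorem finite_weylGroup {R : Finset V} (hR : IsRootSystem R) : Finite (weylGroup R) := by
  let F : weylGroup R → (R → R) := fun w β => ⟨(w : V ≃ₗᵢ[ℝ] V) β, weylGroup_map_mem hR w.2 β β.2⟩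
  refine Finite.of_injective F ?_
  intro w w' h
  have hF : ∀ β ∈ R, (w : V ≃ₗᵢ[ℝ] V) β = (w' : V ≃ₗᵢ[ℝ] V) β := fun β hβ =>
    congrArg Subtype.val (congrFun h ⟨β, hβ⟩)
  let U : Submodule ℝ V := Submodule.span ℝ (R : Set V)
  have hU : ∀ v ∈ U, (w : V ≃ₗᵢ[ℝ] V) v = (w' : V ≃ₗᵢ[ℝ] V) v := by
    intro v hv
    induction hv using Submodule.span_induction with
    | mem x hx => exact hF x hx
    | zero => simp
    | add x y _ _ hx hy => simp [hx, hy]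
    | smul a x _ hx => simp [hx]
  have hUo : ∀ v ∈ Uᗮ, (w : V ≃ₗᵢ[ℝ] V) v = (w' : V ≃ₗᵢ[ℝ] V) v := by
    intro v hv
    have hv' : ∀ α ∈ R, ⟪α, v⟫ = 0 := fun α hα =>
      (Submodule.mem_orthogonal U v).1 hv α (Submodule.subset_span hα)
    rw [weylGroup_fix_orthogonal w.2 hv', weylGroup_fix_orthogonal w'.2 hv']
  have : FiniteDimensional ℝ U := FiniteDimensional.span_finset ℝ R
  apply Subtype.ext
  ext v
  obtain ⟨y, hy, z, hz, rfl⟩ := U.exists_add_mem_mem_orthogonal v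
  rw [map_add, map_add, hU y hy, hUo z hz]

/-- The integrand of `g`: `e^{-|y|²/2} D_k^W(x, y) ∏_{α ∈ R_+} ⟨α, y⟩`. -/
def integrandG (R P : Finset V) (k : V → ℝ) (x y : V) : ℝ :=
  Real.exp (-‖y‖ ^ 2 / 2) * generalizedBessel R P k x y * ∏ α ∈ P, ⟪α, y⟫

/-- `g(x) = ∫_C e^{-|y|²/2} D_k^W(x, y) ∏_{α ∈ R_+} ⟨α, y⟩ dy`, with Lebesgue measure on `V`. -/
def functionG [FiniteDimensional ℝ V] [MeasurableSpace V] [BorelSpace V]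
    (R P : Finset V) (k : V → ℝ) (x : V) : ℝ :=
  ∫ y in weylChamber P, integrandG R P k x y

end Dunkl

end

/-! The argument compares two evaluations of one Gaussian moment. Let `m` be the dimension of `V`,
`N = |R_+|`, and `q` the sum over `w ∈ W` of the translates by `w` of the product `∏ ⟨α, y⟩` cut off
to the chamber. The Gaussian and Lebesgue measure are `W`-invariant, so unfolding the sum in the
generalized Bessel function turns `g` into `∫_V q(y) e^{-|y|²/2} D_k(x, y) dy`
(`functionG_eq_kernelTransform`). Of `q` only measurability, an exponential bound and `q(ty) = t^N
q(y)` for `t > 0` are needed for the eigenvalue equation.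

Applying `T_ξ` under the integral multiplies the integrand by `⟨ξ, y⟩`, so `Δ_k g = ∫ |y|² q
e^{-|y|²/2} D_k dy` (`dunklLaplacian_kernelTransform`). Since `D_k(sx, y) = D_k(x, sy)`, the
substitution `y ↦ sy` gives `s^{m+N} g(sx) = ∫ q e^{-|y|²/(2s²)} D_k(x, y) dy`; differentiating at
`s = 1` yields `(m + N) g + E_1 g` equal to the same integral (`fderiv_radial_kernelTransform`).
Subtracting gives the eigenvalue. Moreover `g(0) > 0` because `D_k(0, y) = 1`.

Most of the work is to control `D_k`, which is only given as a solution of its defining problem. Its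
homogeneous components are built by inverting `n + 1 + ∑ k(α)(1 - σ_α)`. That the radial recursion
already implies the whole Dunkl system follows from commutativity of the Dunkl operators and a
maximum principle (`dunklOp_eq_of_radial`). The construction yields `|D_k(x, y)| ≤ e^{|x||y|}`, and
a Gronwall argument gives uniqueness (`eq_zero_of_dunklOp_eq`). Nonnegativity of `k` enters in the
inversion, the maximum principle and the Gronwall estimate. -/

noncomputable section

namespace Dunkl

variable {V : Type*} [NormedAddCommGroup V] [InnerProductSpace ℝ V]

/-! ### Elementary identities for reflections -/

section Reflections

theorem rootReflection_rootReflection (α x : V) :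
    rootReflection α (rootReflection α x) = x :=
  Submodule.reflection_reflection _ x

theorem inner_rootReflection_left (α x y : V) :
    ⟪rootReflection α x, y⟫ = ⟪x, rootReflection α y⟫ := by
  rw [← LinearIsometryEquiv.inner_map_map (rootReflection α) x,
    rootReflection_rootReflection]

theorem rootReflection_neg (α : V) : rootReflection (-α) = rootReflection α := by
  ext x
  simp [rootReflection_apply, neg_div, sub_eq_add_neg]

theorem rootReflection_self (α : V) : rootReflection α α = -α :=
  Submodule.reflection_orthogonalComplement_singleton_eq_neg α

theorem rootReflection_conj (β α x : V) :
    rootReflection (rootReflection β α) (rootReflection β x) =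
      rootReflection β (rootReflection α x) := by
  rw [rootReflection_apply (rootReflection β α), rootReflection_apply α x]
  simp only [LinearIsometryEquiv.inner_map_map, map_sub, map_smul]

end Reflections

/-! ### Calculus of the reflection difference quotient -/

section Quotient

/-- On the hyperplane `σ_α` fixes `x`, so both sides vanish there. This division-free form removes
the case split from every radial computation. -/
theorem inner_mul_reflectionQuotient (α : V) (f : V → ℝ) (x : V) :
    ⟪α, x⟫ * reflectionQuotient α f x = f x - f (rootReflection α x) := by
  unfold reflectionQuotient
  split_ifs with h
  · simp [rootReflection_apply, h]
  · field_simp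

theorem reflectionQuotient_neg (α : V) (f : V → ℝ) (x : V) :
    reflectionQuotient (-α) f x = -reflectionQuotient α f x := by
  unfold reflectionQuotient
  simp only [inner_neg_left, inner_neg_right, neg_neg, neg_eq_zero, rootReflection_neg, map_neg]
  split_ifs <;> ring

theorem reflectionQuotient_add (α : V) {f g : V → ℝ} {x : V} (hf : DifferentiableAt ℝ f x)
    (hg : DifferentiableAt ℝ g x) :
    reflectionQuotient α (f + g) x = reflectionQuotient α f x + reflectionQuotient α g x := by
  unfold reflectionQuotient
  rw [fderiv_add hf hg]
  split_ifs <;> simp <;> ring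

theorem reflectionQuotient_smul (α : V) (c : ℝ) (f : V → ℝ) (x : V) :
    reflectionQuotient α (c • f) x = c * reflectionQuotient α f x := by
  unfold reflectionQuotient
  rw [fderiv_const_smul_field]
  split_ifs <;> simp <;> ring

theorem fderiv_inner_mul (η ξ : V) {f : V → ℝ} {x : V} (hf : DifferentiableAt ℝ f x) :
    fderiv ℝ (fun x => ⟪η, x⟫ * f x) x ξ = ⟪η, x⟫ * fderiv ℝ f x ξ + ⟪η, ξ⟫ * f x := by
  have h : HasFDerivAt (fun x => ⟪η, x⟫) (innerSL ℝ η) x := (innerSL ℝ η).hasFDerivAt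
  have h' : fderiv ℝ (fun x => ⟪η, x⟫ * f x) x = _ := (h.mul hf.hasFDerivAt).fderiv
  rw [h']
  simp [mul_comm]

/-- A linear form changes under `σ_α` by a multiple of `⟨α, x⟩`, which cancels the denominator. The
factor `2 / ⟨α, α⟩` in the value on the hyperplane makes the ordinary product rule give the same
formula there. -/
theorem reflectionQuotient_inner_mul {α : V} (hα : α ≠ 0) (η : V) {f : V → ℝ} {x : V}
    (hf : DifferentiableAt ℝ f x) :
    reflectionQuotient α (fun x => ⟪η, x⟫ * f x) x =
      ⟪η, x⟫ * reflectionQuotient α f x +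
        2 / ⟪α, α⟫ * ⟪α, η⟫ * f (rootReflection α x) := by
  have hα' : ⟪α, α⟫ ≠ 0 := inner_self_ne_zero.2 hα
  unfold reflectionQuotient
  split_ifs with h
  · rw [fderiv_inner_mul η α hf]
    have h2 : rootReflection α x = x := by simp [rootReflection_apply, h]
    rw [h2, real_inner_comm α η]
    ring
  · have h2 : ⟪η, rootReflection α x⟫ = ⟪η, x⟫ - 2 * ⟪α, x⟫ / ⟪α, α⟫ * ⟪α, η⟫ := by
      rw [rootReflection_apply, inner_sub_right, inner_smul_right, real_inner_comm α η]
    simp only [h2]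
    field_simp
    ring

theorem fderiv_comp_linearIsometryEquiv (σ : V ≃ₗᵢ[ℝ] V) (f : V → ℝ) (x ξ : V) :
    fderiv ℝ (fun x => f (σ x)) x ξ = fderiv ℝ f (σ x) (σ ξ) := by
  have := σ.toContinuousLinearEquiv.comp_right_fderiv (f := f) (x := x)
  exact congrArg (fun L => L ξ) this

theorem reflectionQuotient_comp (β α : V) (f : V → ℝ) (x : V) :
    reflectionQuotient α (fun x => f (rootReflection β x)) x =
      reflectionQuotient (rootReflection β α) f (rootReflection β x) := by
  unfold reflectionQuotient
  simp only [LinearIsometryEquiv.inner_map_map, rootReflection_conj,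
    fderiv_comp_linearIsometryEquiv]

end Quotient

/-! ### Dunkl operators: linearity, product rule, equivariance -/

section Operator

/-- The properties of a positive subsystem with a multiplicity function on which the theory of
Dunkl operators rests: nonnegative weights on nonzero vectors such that weighted sums of even
functions are invariant under the reflections. -/
structure IsReflectionWeight (P : Finset V) (k : V → ℝ) : Prop where
  ne_zero : ∀ α ∈ P, α ≠ 0
  nonneg : ∀ α ∈ P, 0 ≤ k α
  sum_reflection : ∀ β ∈ P, ∀ φ : V → ℝ, (∀ v, φ (-v) = φ v) →
    ∑ α ∈ P, k α * φ (rootReflection β α) = ∑ α ∈ P, k α * φ α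

variable {P : Finset V} {k : V → ℝ}

theorem dunklOp_add (ξ : V) {f g : V → ℝ} (hf : Differentiable ℝ f) (hg : Differentiable ℝ g) :
    dunklOp P k ξ (f + g) = dunklOp P k ξ f + dunklOp P k ξ g := by
  ext x
  simp only [dunklOp, Pi.add_apply, fderiv_add (hf x) (hg x), reflectionQuotient_add _ (hf x) (hg x),
    mul_add, Finset.sum_add_distrib, add_apply]
  ring

theorem dunklOp_smul (ξ : V) (c : ℝ) (f : V → ℝ) :
    dunklOp P k ξ (c • f) = c • dunklOp P k ξ f := by
  ext x
  simp only [dunklOp, Pi.smul_apply, fderiv_const_smul_field, reflectionQuotient_smul,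
    smul_apply, smul_eq_mul, mul_add, Finset.mul_sum]
  congr 1
  exact Finset.sum_congr rfl fun α _ => by ring

theorem dunklOp_zero (ξ : V) : dunklOp P k ξ (0 : V → ℝ) = 0 := by
  simpa using dunklOp_smul (P := P) (k := k) ξ 0 (0 : V → ℝ)

theorem dunklOp_sub (ξ : V) {f g : V → ℝ} (hf : Differentiable ℝ f) (hg : Differentiable ℝ g) :
    dunklOp P k ξ (f - g) = dunklOp P k ξ f - dunklOp P k ξ g := by
  have h : f - g = f + (-1 : ℝ) • g := by ext; simp [sub_eq_add_neg]
  rw [h, dunklOp_add ξ hf (hg.const_smul _), dunklOp_smul]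
  ext; simp [sub_eq_add_neg]

theorem dunklOp_sum {ι : Type*} (s : Finset ι) (ξ : V) {f : ι → V → ℝ}
    (hf : ∀ i ∈ s, Differentiable ℝ (f i)) :
    dunklOp P k ξ (∑ i ∈ s, f i) = ∑ i ∈ s, dunklOp P k ξ (f i) := by
  classical
  induction s using Finset.induction_on with
  | empty => simpa using dunklOp_zero ξ
  | insert i s hi ih =>
    rw [Finset.sum_insert hi, Finset.sum_insert hi,
      dunklOp_add ξ (hf i (by simp)) (Differentiable.sum fun j hj => hf j (by simp [hj])),
      ih fun j hj => hf j (by simp [hj])]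

theorem dunklOp_const (ξ : V) (c : ℝ) : dunklOp P k ξ (fun _ : V => c) = 0 := by
  ext x
  simp [dunklOp, reflectionQuotient]

theorem dunklOp_direction_sub_smul (ξ η : V) (c : ℝ) (f : V → ℝ) (x : V) :
    dunklOp P k (ξ - c • η) f x = dunklOp P k ξ f x - c * dunklOp P k η f x := by
  simp only [dunklOp, map_sub, map_smul, inner_sub_right, inner_smul_right, mul_sub, sub_mul,
    Finset.sum_sub_distrib, mul_add, Finset.mul_sum, smul_eq_mul]
  have : ∑ α ∈ P, k α * (c * ⟪α, η⟫) * reflectionQuotient α f x =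
      ∑ α ∈ P, c * (k α * ⟪α, η⟫ * reflectionQuotient α f x) :=
    Finset.sum_congr rfl fun α _ => by ring
  rw [this]
  ring

theorem dunklOp_direction_sum {ι : Type*} (s : Finset ι) (c : ι → ℝ) (v : ι → V) (f : V → ℝ)
    (x : V) : dunklOp P k (∑ i ∈ s, c i • v i) f x = ∑ i ∈ s, c i * dunklOp P k (v i) f x := by
  simp only [dunklOp, map_sum, map_smul, inner_sum, inner_smul_right, mul_add,
    Finset.sum_add_distrib, smul_eq_mul]
  congr 1
  simp only [Finset.mul_sum, Finset.sum_mul]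
  rw [Finset.sum_comm]
  exact Finset.sum_congr rfl fun i _ => Finset.sum_congr rfl fun α _ => by ring

/-- The Dunkl operator in the radial direction has no singular terms. -/
theorem dunklOp_radial (f : V → ℝ) (x : V) :
    dunklOp P k x f x = fderiv ℝ f x x + ∑ α ∈ P, k α * (f x - f (rootReflection α x)) := by
  simp only [dunklOp, mul_assoc, inner_mul_reflectionQuotient]

theorem dunklOp_inner_mul (hP : IsReflectionWeight P k) (ξ η : V) {f : V → ℝ}
    (hf : Differentiable ℝ f) (x : V) :
    dunklOp P k ξ (fun x => ⟪η, x⟫ * f x) x =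
      ⟪η, x⟫ * dunklOp P k ξ f x + ⟪η, ξ⟫ * f x +
        ∑ α ∈ P, k α * (2 / ⟪α, α⟫) * ⟪α, ξ⟫ * ⟪α, η⟫ * f (rootReflection α x) := by
  have h2 : ∑ α ∈ P, k α * ⟪α, ξ⟫ * reflectionQuotient α (fun x => ⟪η, x⟫ * f x) x =
      ⟪η, x⟫ * ∑ α ∈ P, k α * ⟪α, ξ⟫ * reflectionQuotient α f x +
      ∑ α ∈ P, k α * (2 / ⟪α, α⟫) * ⟪α, ξ⟫ * ⟪α, η⟫ * f (rootReflection α x) := by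
    rw [Finset.mul_sum, ← Finset.sum_add_distrib]
    refine Finset.sum_congr rfl fun α hα => ?_
    rw [reflectionQuotient_inner_mul (hP.ne_zero α hα) η (hf x)]
    ring
  unfold dunklOp
  rw [h2, fderiv_inner_mul η ξ (hf x)]
  ring

/-- The reflection need not preserve `P`, but each summand is a product of two factors odd in the
root, hence even, so `sum_reflection` applies. -/
theorem dunklOp_comp_rootReflection (hP : IsReflectionWeight P k) {β : V} (hβ : β ∈ P) (ξ : V)
    (f : V → ℝ) (x : V) :
    dunklOp P k ξ (fun x => f (rootReflection β x)) x =
      dunklOp P k (rootReflection β ξ) f (rootReflection β x) := by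
  have h := hP.sum_reflection β hβ
    (fun v => ⟪v, rootReflection β ξ⟫ * reflectionQuotient v f (rootReflection β x))
    (fun v => by simp [reflectionQuotient_neg])
  simp only [LinearIsometryEquiv.inner_map_map] at h
  simp only [dunklOp, fderiv_comp_linearIsometryEquiv, reflectionQuotient_comp, mul_assoc, h]

end Operator

/-! ### Homogeneous polynomials and commutativity of Dunkl operators -/

section Polynomials

variable (V) in
/-- The linear forms on `V`, as functions. -/
def linearForms : Submodule ℝ (V → ℝ) where
  carrier := Set.range fun η x => ⟪η, x⟫
  zero_mem' := ⟨0, by ext; simp⟩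
  add_mem' := by
    rintro _ _ ⟨η, rfl⟩ ⟨ζ, rfl⟩
    exact ⟨η + ζ, by ext; simp [inner_add_left]⟩
  smul_mem' := by
    rintro c _ ⟨η, rfl⟩
    exact ⟨c • η, by ext; simp [inner_smul_left]⟩

/-- Induction for homogeneous polynomial functions, the elements of `linearForms V ^ n`. -/
theorem homogeneous_induction {C : ℕ → (V → ℝ) → Prop} (hconst : ∀ c : ℝ, C 0 fun _ => c)
    (hadd : ∀ n, ∀ f ∈ linearForms V ^ n, ∀ g ∈ linearForms V ^ n, C n f → C n g → C n (f + g))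
    (hmul : ∀ n, ∀ f ∈ linearForms V ^ n, ∀ η : V, C n f → C (n + 1) fun x => ⟪η, x⟫ * f x)
    {n : ℕ} {f : V → ℝ} (hf : f ∈ linearForms V ^ n) : C n f := by
  induction hf using Submodule.pow_induction_on_left' with
  | algebraMap r => exact hconst r
  | add x y i hx hy ihx ihy => exact hadd i x hx y hy ihx ihy
  | mem_mul l hl i x hx ih =>
    obtain ⟨η, rfl⟩ := hl
    exact hmul i x hx η ih

theorem inner_mul_mem_linearForms_pow {n : ℕ} {f : V → ℝ} (hf : f ∈ linearForms V ^ n) (η : V) :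
    (fun x => ⟪η, x⟫ * f x) ∈ linearForms V ^ (n + 1) := by
  rw [pow_succ']
  exact Submodule.mul_mem_mul (⟨η, rfl⟩ : (fun x => ⟪η, x⟫) ∈ linearForms V) hf

theorem const_mem_linearForms_pow_zero (c : ℝ) : (fun _ => c) ∈ linearForms V ^ 0 := by
  rw [pow_zero, Submodule.mem_one]
  exact ⟨c, rfl⟩

theorem contDiff_of_mem_linearForms_pow {n : ℕ} {f : V → ℝ} (hf : f ∈ linearForms V ^ n) :
    ContDiff ℝ ⊤ f :=
  homogeneous_induction (C := fun _ f => ContDiff ℝ ⊤ f) (fun _ => contDiff_const)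
    (fun _ _ _ _ _ hf hg => hf.add hg)
    (fun _ _ _ η hf => (innerSL ℝ η).contDiff.mul hf) hf

theorem differentiable_of_mem_linearForms_pow {n : ℕ} {f : V → ℝ} (hf : f ∈ linearForms V ^ n) :
    Differentiable ℝ f :=
  (contDiff_of_mem_linearForms_pow hf).differentiable (by simp)

theorem comp_rootReflection_mem_linearForms_pow (β : V) {n : ℕ} {f : V → ℝ}
    (hf : f ∈ linearForms V ^ n) : (fun x => f (rootReflection β x)) ∈ linearForms V ^ n := by
  refine homogeneous_induction (C := fun n f => (fun x => f (rootReflection β x)) ∈ linearForms V ^ n)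
    const_mem_linearForms_pow_zero (fun _ _ _ _ _ hf hg => add_mem hf hg)
    (fun n f _ η hf => ?_) hf
  simp only [← inner_rootReflection_left]
  exact inner_mul_mem_linearForms_pow hf _

/-- Euler's identity. -/
theorem fderiv_radial_of_mem_linearForms_pow {n : ℕ} {f : V → ℝ} (hf : f ∈ linearForms V ^ n)
    (x : V) : fderiv ℝ f x x = n * f x := by
  refine homogeneous_induction (C := fun n f => fderiv ℝ f x x = n * f x) (fun c => by simp)
    (fun n f hf g hg h1 h2 => ?_) (fun n f hf η h => ?_) hf
  · rw [fderiv_add (differentiable_of_mem_linearForms_pow hf x)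
      (differentiable_of_mem_linearForms_pow hg x)]
    simp [h1, h2]; ring
  · rw [fderiv_inner_mul η x (differentiable_of_mem_linearForms_pow hf x), h]
    push_cast; ring

variable {P : Finset V} {k : V → ℝ}

theorem dunklOp_inner_mul_eq (hP : IsReflectionWeight P k) (ξ η : V) {f : V → ℝ}
    (hf : Differentiable ℝ f) :
    dunklOp P k ξ (fun x => ⟪η, x⟫ * f x) =
      (fun x => ⟪η, x⟫ * dunklOp P k ξ f x) + ⟪η, ξ⟫ • f +
        ∑ α ∈ P, (k α * (2 / ⟪α, α⟫) * ⟪α, ξ⟫ * ⟪α, η⟫) • fun x => f (rootReflection α x) := by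
  ext x
  simp [dunklOp_inner_mul hP ξ η hf]

/-- Degree 0 is kept apart because truncated subtraction would lose information: in passing from
degree 0 to degree 1, the term `⟪η, x⟫ * T_ξ f` has degree 0 only because `T_ξ f` vanishes. -/
theorem dunklOp_mem_aux (hP : IsReflectionWeight P k) (ξ : V) {n : ℕ} {f : V → ℝ}
    (hf : f ∈ linearForms V ^ n) :
    (n = 0 → dunklOp P k ξ f = 0) ∧ ∀ m, n = m + 1 → dunklOp P k ξ f ∈ linearForms V ^ m := by
  refine homogeneous_induction (C := fun n f => (n = 0 → dunklOp P k ξ f = 0) ∧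
    ∀ m, n = m + 1 → dunklOp P k ξ f ∈ linearForms V ^ m)
    (fun c => ⟨fun _ => dunklOp_const ξ c, by simp⟩)
    (fun n f hf g hg h1 h2 => ?_) (fun n f hf η h => ⟨by simp, ?_⟩) hf
  · rw [dunklOp_add ξ (differentiable_of_mem_linearForms_pow hf)
      (differentiable_of_mem_linearForms_pow hg)]
    exact ⟨fun h => by rw [h1.1 h, h2.1 h, add_zero], fun m h => add_mem (h1.2 m h) (h2.2 m h)⟩
  · rintro m hm
    obtain rfl : n = m := by omega
    rw [dunklOp_inner_mul_eq hP ξ η (differentiable_of_mem_linearForms_pow hf)]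
    refine add_mem (add_mem ?_ (Submodule.smul_mem _ _ hf)) (Submodule.sum_mem _ fun α _ =>
      Submodule.smul_mem _ _ (comp_rootReflection_mem_linearForms_pow α hf))
    rcases n with _ | n
    · simp only [h.1 rfl, Pi.zero_apply, mul_zero]
      exact Submodule.zero_mem _
    · exact inner_mul_mem_linearForms_pow (h.2 n rfl) η

theorem dunklOp_eq_zero (hP : IsReflectionWeight P k) (ξ : V) {f : V → ℝ}
    (hf : f ∈ linearForms V ^ 0) : dunklOp P k ξ f = 0 :=
  (dunklOp_mem_aux hP ξ hf).1 rfl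

theorem dunklOp_mem (hP : IsReflectionWeight P k) (ξ : V) {n : ℕ} {f : V → ℝ}
    (hf : f ∈ linearForms V ^ (n + 1)) : dunklOp P k ξ f ∈ linearForms V ^ n :=
  (dunklOp_mem_aux hP ξ hf).2 n rfl

theorem dunklOp_mem_pred (hP : IsReflectionWeight P k) (ξ : V) {n : ℕ} {f : V → ℝ}
    (hf : f ∈ linearForms V ^ n) : dunklOp P k ξ f ∈ linearForms V ^ (n - 1) := by
  rcases n with _ | n
  · rw [dunklOp_eq_zero hP ξ hf]; exact Submodule.zero_mem _
  · exact dunklOp_mem hP ξ hf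

/-- Dunkl operators commute on polynomial functions. -/
theorem dunklOp_comm (hP : IsReflectionWeight P k) (ξ η : V) {n : ℕ} {f : V → ℝ}
    (hf : f ∈ linearForms V ^ n) :
    dunklOp P k ξ (dunklOp P k η f) = dunklOp P k η (dunklOp P k ξ f) := by
  refine homogeneous_induction
    (C := fun _ f => dunklOp P k ξ (dunklOp P k η f) = dunklOp P k η (dunklOp P k ξ f))
    (fun c => by simp only [dunklOp_const, dunklOp_zero])
    (fun n f hf g hg h1 h2 => ?_) (fun n f hf ζ h => ?_) hf
  · have d : ∀ {f} (ξ : V), f ∈ linearForms V ^ n → Differentiable ℝ (dunklOp P k ξ f) :=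
      fun ξ hf => differentiable_of_mem_linearForms_pow (dunklOp_mem_pred hP ξ hf)
    have d' : ∀ {f}, f ∈ linearForms V ^ n → Differentiable ℝ f :=
      differentiable_of_mem_linearForms_pow
    rw [dunklOp_add η (d' hf) (d' hg), dunklOp_add ξ (d' hf) (d' hg), dunklOp_add ξ (d η hf) (d η hg),
      dunklOp_add η (d ξ hf) (d ξ hg), h1, h2]
  · have d : Differentiable ℝ f := differentiable_of_mem_linearForms_pow hf
    -- Apart from the first term, which the induction hypothesis handles, the right-hand side is
    -- symmetric in `ξ` and `η`.
    have key : ∀ ξ η x, dunklOp P k ξ (dunklOp P k η (fun x => ⟪ζ, x⟫ * f x)) x =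
        ⟪ζ, x⟫ * dunklOp P k ξ (dunklOp P k η f) x + ⟪ζ, ξ⟫ * dunklOp P k η f x
        + ⟪ζ, η⟫ * dunklOp P k ξ f x
        + ∑ α ∈ P, (k α * (2 / ⟪α, α⟫) * ⟪α, ζ⟫ * (⟪α, ξ⟫ * dunklOp P k η f (rootReflection α x)
          + ⟪α, η⟫ * dunklOp P k ξ f (rootReflection α x)
          - 2 / ⟪α, α⟫ * ⟪α, ξ⟫ * ⟪α, η⟫ * dunklOp P k α f (rootReflection α x))) := by
      intro ξ η x
      have dT : Differentiable ℝ (dunklOp P k η f) :=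
        differentiable_of_mem_linearForms_pow (dunklOp_mem_pred hP η hf)
      have dR : ∀ α, Differentiable ℝ fun x => f (rootReflection α x) := fun α =>
        differentiable_of_mem_linearForms_pow (comp_rootReflection_mem_linearForms_pow α hf)
      have dl : Differentiable ℝ fun x => ⟪ζ, x⟫ * dunklOp P k η f x :=
        differentiable_of_mem_linearForms_pow
          (inner_mul_mem_linearForms_pow (dunklOp_mem_pred hP η hf) ζ)
      rw [dunklOp_inner_mul_eq hP η ζ d,
        dunklOp_add ξ (dl.add (d.const_smul _)) (Differentiable.sum fun α _ => (dR α).const_smul _),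
        dunklOp_add ξ dl (d.const_smul _), dunklOp_sum _ _ (fun α _ => (dR α).const_smul _),
        dunklOp_smul]
      simp only [Pi.add_apply, dunklOp_inner_mul hP ξ ζ dT, dunklOp_smul, Pi.smul_apply,
        Finset.sum_apply, smul_eq_mul]
      -- Equivariance moves the reflection from the function to the direction, and expanding `σ_α ξ`
      -- produces the correction along `α`.
      have e : ∀ α ∈ P, k α * (2 / ⟪α, α⟫) * ⟪α, η⟫ * ⟪α, ζ⟫ *
          dunklOp P k ξ (fun x => f (rootReflection α x)) x = k α * (2 / ⟪α, α⟫) * ⟪α, η⟫ * ⟪α, ζ⟫ *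
          (dunklOp P k ξ f (rootReflection α x) -
            2 / ⟪α, α⟫ * ⟪α, ξ⟫ * dunklOp P k α f (rootReflection α x)) := by
        intro α hα
        rw [dunklOp_comp_rootReflection hP hα, rootReflection_apply α ξ,
          dunklOp_direction_sub_smul]
        ring
      have e' : ∀ a b c s t : ℝ, a + b + s + (c + t) = a + b + c + (s + t) := by intros; ring
      rw [Finset.sum_congr rfl e, add_assoc (_ + _ + ∑ α ∈ P, _), e', ← Finset.sum_add_distrib]
      congr 1
      exact Finset.sum_congr rfl fun α _ => by ring
    ext x
    rw [key, key, h]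
    have : ∀ a b c s t : ℝ, s = t → a + b + c + s = a + c + b + t := by
      intros; subst_vars; ring
    refine this _ _ _ _ _ (Finset.sum_congr rfl fun α _ => by ring)

end Polynomials

/-! ### From the radial equation to the full Dunkl system -/

section Intertwining

/-- A maximum principle for `c + ∑ k_i (1 - τ_i)`. -/
theorem eq_zero_of_add_sum_sub_eq_zero {X ι : Type*} [TopologicalSpace X] {K : Set X}
    (hK : IsCompact K) {F : X → ℝ} (hF : ContinuousOn F K) {s : Finset ι} {k : ι → ℝ}
    (hk : ∀ i ∈ s, 0 ≤ k i) {τ : ι → X → X} (hτ : ∀ i ∈ s, ∀ p ∈ K, τ i p ∈ K) {c : ℝ}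
    (hc : 0 < c) (h : ∀ p ∈ K, c * F p + ∑ i ∈ s, k i * (F p - F (τ i p)) = 0) :
    ∀ p ∈ K, F p = 0 := by
  intro p hp
  obtain ⟨q, hq, hmax⟩ := hK.exists_isMaxOn ⟨p, hp⟩ hF.abs
  -- At a maximum point `q` of `|F|` every difference `F q - F (τ i q)` has the sign of `F q`, up to
  -- vanishing; multiplying the equation by `F q` makes all terms nonnegative.
  have h1 : 0 ≤ ∑ i ∈ s, k i * (F q * (F q - F (τ i q))) := by
    refine Finset.sum_nonneg fun i hi => mul_nonneg (hk i hi) ?_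
    have h2 : |F (τ i q)| ≤ |F q| := hmax (hτ i hi q hq)
    have h3 : F q * F (τ i q) ≤ |F q| * |F q| :=
      (le_abs_self _).trans (by rw [abs_mul]; gcongr)
    rw [abs_mul_abs_self] at h3
    linarith
  have h4 : c * (F q * F q) + ∑ i ∈ s, k i * (F q * (F q - F (τ i q))) = 0 := by
    have := congrArg (fun t => F q * t) (h q hq)
    simp only [mul_add, Finset.mul_sum, mul_zero] at this
    rw [← this]
    congr 1
    · ring
    · exact Finset.sum_congr rfl fun i _ => by ring
  have h5 : F q * F q = 0 := by
    have := mul_self_nonneg (F q)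
    nlinarith
  have h6 : |F p| ≤ |F q| := hmax hp
  rw [mul_self_eq_zero.1 h5, abs_zero] at h6
  exact abs_nonpos_iff.1 h6

variable {P : Finset V} {k : V → ℝ}

/-- If `T_ξ E = ⟨ξ, y⟩ E'` for all `ξ`, then the radial equation
`∑ x_i T_i F = ⟨x, y⟩ E` for homogeneous polynomials implies `T_ξ F = ⟨ξ, y⟩ E` for all `ξ`. -/
theorem dunklOp_eq_of_radial [FiniteDimensional ℝ V] (hP : IsReflectionWeight P k) {n : ℕ} (y : V)
    {F E E' : V → ℝ} (hF : F ∈ linearForms V ^ (n + 1)) (hE : E ∈ linearForms V ^ n)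
    (hTE : ∀ ξ, dunklOp P k ξ E = ⟪ξ, y⟫ • E')
    (hrad : ∀ x, (n + 1) * F x + ∑ α ∈ P, k α * (F x - F (rootReflection α x)) = ⟪x, y⟫ * E x)
    (ξ : V) : dunklOp P k ξ F = ⟪ξ, y⟫ • E := by
  let b := stdOrthonormalBasis ℝ V
  -- The defect of the desired equation. It is linear in the direction, and the radial hypothesis
  -- says exactly `U x x = 0`.
  let U : V → V → ℝ := fun ξ => dunklOp P k ξ F - ⟪ξ, y⟫ • E
  have hUmem : ∀ ξ, U ξ ∈ linearForms V ^ n := fun ξ =>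
    sub_mem (dunklOp_mem hP ξ hF) (Submodule.smul_mem _ _ hE)
  have hUdiff : ∀ ξ, Differentiable ℝ (U ξ) := fun ξ =>
    differentiable_of_mem_linearForms_pow (hUmem ξ)
  have hUrad : ∀ x, U x x = 0 := by
    intro x
    have h := hrad x
    simp only [U, Pi.sub_apply, Pi.smul_apply, smul_eq_mul, dunklOp_radial,
      fderiv_radial_of_mem_linearForms_pow hF]
    push_cast
    linarith
  have hUsum : ∀ c : Fin _ → ℝ, ∀ x, U (∑ i, c i • b i) x = ∑ i, c i * U (b i) x := by
    intro c x
    simp only [U, Pi.sub_apply, Pi.smul_apply, smul_eq_mul, dunklOp_direction_sum, sum_inner,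
      inner_smul_left, mul_sub, Finset.sum_sub_distrib, Finset.sum_mul, RCLike.conj_to_real,
      mul_assoc]
  have hUexp : ∀ η x, U η x = ∑ i, ⟪b i, η⟫ * U (b i) x := by
    intro η x
    rw [← hUsum, b.sum_repr']
  have hcomm : ∀ ξ η, dunklOp P k η (U ξ) = dunklOp P k ξ (U η) := by
    intro ξ η
    have d1 : ∀ ξ, Differentiable ℝ (dunklOp P k ξ F) := fun ξ =>
      differentiable_of_mem_linearForms_pow (dunklOp_mem hP ξ hF)
    have d2 : Differentiable ℝ E := differentiable_of_mem_linearForms_pow hE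
    simp only [U]
    rw [dunklOp_sub η (d1 ξ) (d2.const_smul _), dunklOp_sub ξ (d1 η) (d2.const_smul _),
      dunklOp_comm hP ξ η hF, dunklOp_smul, dunklOp_smul, hTE, hTE, smul_comm]
  -- Apply `T_η` to the identity `∑ x_i U(b i) = 0`. By `hcomm` the main terms form `∑ x_i T_i (U
  -- η)`, the radial operator on `U η`; the product-rule corrections replace `U η ∘ σ_α` by `U (σ_α
  -- η) ∘ σ_α` and raise the Euler factor `n` to `n + 1`.
  have hmain : ∀ η x, (n + 1) * U η x +
      ∑ α ∈ P, k α * (U η x - U (rootReflection α η) (rootReflection α x)) = 0 := by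
    intro η x
    have hzero : (∑ i, fun x => ⟪b i, x⟫ * U (b i) x) = (0 : V → ℝ) := by
      ext x
      simpa [← hUexp] using hUrad x
    have h1 : dunklOp P k η (∑ i, fun x => ⟪b i, x⟫ * U (b i) x) x = 0 := by
      rw [hzero, dunklOp_zero]; rfl
    rw [dunklOp_sum _ _ fun i _ => differentiable_of_mem_linearForms_pow
      (inner_mul_mem_linearForms_pow (hUmem _) _), Finset.sum_apply] at h1
    simp only [dunklOp_inner_mul hP η _ (hUdiff _), hcomm _ η, Finset.sum_add_distrib,
      ← hUexp] at h1
    rw [← dunklOp_direction_sum, b.sum_repr', dunklOp_radial,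
      fderiv_radial_of_mem_linearForms_pow (hUmem η), Finset.sum_comm] at h1
    have h2 : ∀ α ∈ P, ∑ i, k α * (2 / ⟪α, α⟫) * ⟪α, η⟫ * ⟪α, b i⟫ * U (b i) (rootReflection α x)
        = k α * (U η (rootReflection α x) - U (rootReflection α η) (rootReflection α x)) := by
      intro α _
      have h3 : U (rootReflection α η) (rootReflection α x) = U η (rootReflection α x)
          - 2 * ⟪α, η⟫ / ⟪α, α⟫ * U α (rootReflection α x) := by
        simp only [U, Pi.sub_apply, Pi.smul_apply, smul_eq_mul, rootReflection_apply α η,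
          dunklOp_direction_sub_smul, inner_sub_left, inner_smul_left, RCLike.conj_to_real]
        ring
      rw [h3, hUexp α, sub_sub_cancel, Finset.mul_sum, Finset.mul_sum]
      refine Finset.sum_congr rfl fun i _ => ?_
      rw [real_inner_comm α (b i)]
      ring
    rw [Finset.sum_congr rfl h2] at h1
    have h4 : ∀ a s t u : ℝ, a * u + s + u + t = 0 → s + t = -((a + 1) * u) := by
      intros; linarith
    have h5 := h4 _ _ _ _ h1
    rw [← Finset.sum_add_distrib] at h5
    have h6 : ∑ α ∈ P, k α * (U η x - U (rootReflection α η) (rootReflection α x)) =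
        -((n + 1) * U η x) := by
      rw [← h5]
      exact Finset.sum_congr rfl fun α _ => by ring
    rw [h6]; ring
  have hcont : Continuous fun p : V × V => U p.1 p.2 := by
    simp only [fun p : V × V => hUexp p.1 p.2]
    exact continuous_finsetSum _ fun i _ =>
      (continuous_const.inner continuous_fst).mul ((hUdiff _).continuous.comp continuous_snd)
  have hU0 : ∀ x, U ξ x = 0 := by
    intro x
    -- The maximum principle is used on pairs (direction, point), with `σ_α` acting on both; a
    -- product of balls is compact and stable under isometries.
    let K : Set (V × V) := Metric.closedBall 0 ‖ξ‖ ×ˢ Metric.closedBall 0 ‖x‖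
    have := eq_zero_of_add_sum_sub_eq_zero (K := K)
      ((isCompact_closedBall _ _).prod (isCompact_closedBall _ _)) hcont.continuousOn
      (s := P) (k := k) hP.nonneg (τ := fun α p => (rootReflection α p.1, rootReflection α p.2))
      (by simp [K]) (c := n + 1) (by positivity) (fun p _ => hmain p.1 p.2) (ξ, x) (by simp [K])
    exact this
  ext x
  have := hU0 x
  simp only [U, Pi.sub_apply] at this
  linarith

end Intertwining

/-! ### Multilinear forms on the diagonal -/

section Diagonal

theorem prod_inner_mem_linearForms_pow {n : ℕ} (v : Fin n → V) :
    (fun x => ∏ i, ⟪v i, x⟫) ∈ linearForms V ^ n := by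
  induction n with
  | zero => simpa using const_mem_linearForms_pow_zero 1
  | succ n ih =>
    simp only [Fin.prod_univ_succ]
    exact inner_mul_mem_linearForms_pow (ih _) _

theorem diag_mem_linearForms_pow [FiniteDimensional ℝ V] {n : ℕ} (M : V [×n]→L[ℝ] ℝ) :
    (fun x => M fun _ => x) ∈ linearForms V ^ n := by
  let b := stdOrthonormalBasis ℝ V
  have h : (fun x => M fun _ => x) =
      ∑ r : Fin n → Fin _, M (fun i => b (r i)) • fun x => ∏ i, ⟪b (r i), x⟫ := by
    ext x
    conv_lhs => rw [← b.sum_repr' x]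
    rw [M.map_sum]
    simp [M.map_smul_univ, mul_comm]
  rw [h]
  exact Submodule.sum_mem _ fun r _ => Submodule.smul_mem _ _ (prod_inner_mem_linearForms_pow _)

theorem hasFDerivAt_diag {n : ℕ} (M : V [×n]→L[ℝ] ℝ) (x : V) :
    HasFDerivAt (fun x => M fun _ => x)
      ((M.linearDeriv fun _ => x).comp (ContinuousLinearMap.pi fun _ => .id ℝ V)) x :=
  (M.hasFDerivAt fun _ => x).comp x
    (ContinuousLinearMap.pi fun _ : Fin n => ContinuousLinearMap.id ℝ V).hasFDerivAt

theorem fderiv_diag_apply {n : ℕ} (M : V [×n]→L[ℝ] ℝ) (x ξ : V) :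
    fderiv ℝ (fun x => M fun _ => x) x ξ = ∑ i, M (Function.update (fun _ => x) i ξ) := by
  rw [(hasFDerivAt_diag M x).fderiv]
  simp

/-- Differentiation costs a factor `n`, absorbed by `n ≤ 2 ^ n`, while `1 ≤ r` lets `r ^ (n - 1)` be
replaced by `r ^ n`. The majorant is thus again a power series in `‖M‖`. -/
theorem norm_fderiv_diag_le {n : ℕ} (M : V [×n]→L[ℝ] ℝ) {r : ℝ} (hr : 1 ≤ r) {x : V}
    (hx : ‖x‖ ≤ r) : ‖fderiv ℝ (fun x => M fun _ => x) x‖ ≤ ‖M‖ * (2 * r) ^ n := by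
  refine ContinuousLinearMap.opNorm_le_bound _ (by positivity) fun ξ => ?_
  rw [fderiv_diag_apply]
  have h : ∀ i : Fin n, ‖M (Function.update (fun _ => x) i ξ)‖ ≤ ‖M‖ * (r ^ n * ‖ξ‖) := by
    intro i
    refine (M.le_opNorm _).trans ?_
    gcongr
    rw [← Finset.mul_prod_erase _ _ (Finset.mem_univ i), Function.update_self, mul_comm]
    gcongr
    calc ∏ j ∈ Finset.univ.erase i, ‖Function.update (fun _ => x) i ξ j‖
        ≤ ∏ j ∈ Finset.univ.erase i, r := by
          refine Finset.prod_le_prod (fun _ _ => norm_nonneg _) fun j hj => ?_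
          rw [Function.update_of_ne (Finset.ne_of_mem_erase hj)]
          exact hx
      _ ≤ r ^ n := by
          rw [Finset.prod_const]
          refine pow_le_pow_right₀ hr ?_
          exact (Finset.card_le_univ _).trans (by simp)
  refine (norm_sum_le_of_le _ fun i _ => h i).trans ?_
  have h2 : (n : ℝ) ≤ 2 ^ n := by exact_mod_cast Nat.lt_two_pow_self.le
  simp only [Finset.sum_const, Finset.card_univ, Fintype.card_fin, nsmul_eq_mul, mul_pow]
  calc (n : ℝ) * (‖M‖ * (r ^ n * ‖ξ‖)) ≤ 2 ^ n * (‖M‖ * (r ^ n * ‖ξ‖)) := by gcongr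
    _ = _ := by ring

end Diagonal

/-! ### Termwise action of Dunkl operators on entire series -/

section Series

variable {p : FormalMultilinearSeries ℝ V ℝ}

theorem hasSum_diag (hp : p.radius = ⊤) (x : V) : HasSum (fun n => p n fun _ => x) (p.sum x) := by
  refine Summable.hasSum ?_
  refine .of_norm_bounded (p.radius_eq_top_iff_summable_norm.1 hp ‖x‖₊) fun n => ?_
  simpa using (p n).le_opNorm fun _ => x

theorem analyticOnNhd_sum [CompleteSpace V] (hp : p.radius = ⊤) :
    AnalyticOnNhd ℝ p.sum Set.univ := by
  have h := p.hasFPowerSeriesOnBall (by simp [hp])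
  rw [hp] at h
  simpa using h.analyticOnNhd

theorem hasSum_fderiv_diag (hp : p.radius = ⊤) (x : V) :
    HasSum (fun n => fderiv ℝ (fun x => p n fun _ => x) x) (fderiv ℝ p.sum x) := by
  -- This puts `x` in the open ball of radius `r` and ensures `1 ≤ r`.
  let r : ℝ := ‖x‖ + 1
  have hr : 1 ≤ r := by simp [r]
  have hu : Summable fun n => ‖p n‖ * (2 * r) ^ n :=
    p.radius_eq_top_iff_summable_norm.1 hp ⟨2 * r, by positivity⟩
  have hb : ∀ n, ∀ z ∈ Metric.ball (0 : V) r,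
      ‖fderiv ℝ (fun x => p n fun _ => x) z‖ ≤ ‖p n‖ * (2 * r) ^ n := fun n z hz =>
    norm_fderiv_diag_le (p n) hr (by simpa using (mem_ball_zero_iff.1 hz).le)
  have hx : x ∈ Metric.ball (0 : V) r := by simp [r]
  have h := hasFDerivAt_tsum_of_isPreconnected hu Metric.isOpen_ball
    (convex_ball (0 : V) r).isPreconnected
    (fun n z _ => (hasFDerivAt_diag (p n) z).differentiableAt.hasFDerivAt) hb hx
    (hasSum_diag hp x).summable hx
  have h' : fderiv ℝ p.sum x = _ := h.fderiv
  rw [h']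
  exact (Summable.of_norm_bounded hu fun n => hb n x hx).hasSum

variable {P : Finset V} {k : V → ℝ}

theorem hasSum_reflectionQuotient_diag (hp : p.radius = ⊤) (α x : V) :
    HasSum (fun n => reflectionQuotient α (fun x => p n fun _ => x) x)
      (reflectionQuotient α p.sum x) := by
  unfold reflectionQuotient
  split_ifs
  · exact ((ContinuousLinearMap.apply ℝ ℝ α).hasSum (hasSum_fderiv_diag hp x)).mul_left _
  · exact ((hasSum_diag hp x).sub (hasSum_diag hp _)).div_const _

/-- Dunkl operators act termwise on entire series. -/
theorem hasSum_dunklOp_diag (hp : p.radius = ⊤) (ξ x : V) :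
    HasSum (fun n => dunklOp P k ξ (fun x => p n fun _ => x) x) (dunklOp P k ξ p.sum x) := by
  unfold dunklOp
  exact ((ContinuousLinearMap.apply ℝ ℝ ξ).hasSum (hasSum_fderiv_diag hp x)).add
    (hasSum_sum fun α _ => (hasSum_reflectionQuotient_diag hp α x).mul_left _)

end Series

/-! ### Recursive construction of the homogeneous components of the kernel -/

section Coefficients

/-- Neumann series after factoring out `c`. -/
theorem isUnit_smul_one_sub {X : Type*} [NormedRing X] [NormedAlgebra ℝ X]
    [CompleteSpace X] {K : X} {c : ℝ} (hK : ‖K‖ < c) :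
    IsUnit (c • (1 : X) - K) := by
  have hc : 0 < c := (norm_nonneg K).trans_lt hK
  have h1 : ‖c⁻¹ • K‖ < 1 := by
    rw [norm_smul, norm_inv, Real.norm_of_nonneg hc.le, inv_mul_lt_iff₀ hc, mul_one]
    exact hK
  have h2 : c • (1 : X) - K = algebraMap ℝ X c * (1 - c⁻¹ • K) := by
    rw [← Algebra.smul_def, smul_sub, smul_inv_smul₀ hc.ne']
  rw [h2]
  exact ((isUnit_iff_ne_zero.2 hc.ne').map (algebraMap ℝ X)).mul (isUnit_one_sub_of_norm_lt_one h1)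

/-- The operator `M ↦ ∑ k(α) M ∘ σ_α` on multilinear forms. -/
def reflectionSum (P : Finset V) (k : V → ℝ) (n : ℕ) :
    (V [×n]→L[ℝ] ℝ) →L[ℝ] (V [×n]→L[ℝ] ℝ) :=
  ∑ α ∈ P, k α • ContinuousMultilinearMap.compContinuousLinearMapL
    fun _ => (rootReflection α : V →L[ℝ] V)

/-- The inverse of `n + 1 + ∑ k(α) (1 - σ_α)` on multilinear forms. -/
def radialInverse (P : Finset V) (k : V → ℝ) (n : ℕ) :
    (V [×(n + 1)]→L[ℝ] ℝ) →L[ℝ] (V [×(n + 1)]→L[ℝ] ℝ) :=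
  Ring.inverse ((n + 1 + ∑ α ∈ P, k α : ℝ) • 1 - reflectionSum P k (n + 1))

/-- The homogeneous components of the Dunkl kernel, as multilinear forms. -/
def kernelCoeff (P : Finset V) (k : V → ℝ) (y : V) : (n : ℕ) → V [×n]→L[ℝ] ℝ
  | 0 => ContinuousMultilinearMap.uncurry0 ℝ V 1
  | n + 1 => radialInverse P k n
      ((continuousMultilinearCurryLeftEquiv ℝ (fun _ : Fin (n + 1) => V) ℝ).symm
        ((innerSL ℝ y).smulRight (kernelCoeff P k y n)))

variable {P : Finset V} {k : V → ℝ}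

theorem reflectionSum_apply (n : ℕ) (M : V [×n]→L[ℝ] ℝ) (v : Fin n → V) :
    reflectionSum P k n M v = ∑ α ∈ P, k α * M fun i => rootReflection α (v i) := by
  simp [reflectionSum]

theorem norm_reflectionSum_le (hk : ∀ α ∈ P, 0 ≤ k α) (n : ℕ) :
    ‖reflectionSum P k n‖ ≤ ∑ α ∈ P, k α := by
  refine ContinuousLinearMap.opNorm_le_bound _ (Finset.sum_nonneg hk) fun M => ?_
  have h : reflectionSum P k n M = ∑ α ∈ P, k α • M.compContinuousLinearMap
      fun _ => (rootReflection α : V →L[ℝ] V) := by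
    ext v; simp [reflectionSum_apply]
  rw [h, Finset.sum_mul]
  refine norm_sum_le_of_le _ fun α hα => ?_
  rw [norm_smul, Real.norm_of_nonneg (hk α hα),
    ContinuousMultilinearMap.norm_compContinuous_linearIsometryEquiv]

theorem radialInverse_spec (hk : ∀ α ∈ P, 0 ≤ k α) (n : ℕ) (Q : V [×(n + 1)]→L[ℝ] ℝ) :
    (n + 1 + ∑ α ∈ P, k α : ℝ) • radialInverse P k n Q -
      reflectionSum P k (n + 1) (radialInverse P k n Q) = Q := by
  have hu : IsUnit ((n + 1 + ∑ α ∈ P, k α : ℝ) • 1 - reflectionSum P k (n + 1)) := by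
    refine isUnit_smul_one_sub
      (X := (V [×(n + 1)]→L[ℝ] ℝ) →L[ℝ] (V [×(n + 1)]→L[ℝ] ℝ)) ?_
    have := norm_reflectionSum_le hk (n + 1)
    have : (0 : ℝ) ≤ n := n.cast_nonneg
    linarith
  exact congrArg (fun A => A Q) (Ring.mul_inverse_cancel _ hu)

/-- The contribution `∑ k(α)` to the scalar part cancels against the norm bound of the reflection
sum, so the estimate is the one for `k = 0`. This is why the kernel obeys the same bound as the
exponential. -/
theorem norm_radialInverse_le (hk : ∀ α ∈ P, 0 ≤ k α) (n : ℕ) (Q : V [×(n + 1)]→L[ℝ] ℝ) :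
    (n + 1) * ‖radialInverse P k n Q‖ ≤ ‖Q‖ := by
  have h := radialInverse_spec hk n Q
  set N := radialInverse P k n Q
  have h0 : 0 ≤ ∑ α ∈ P, k α := Finset.sum_nonneg hk
  have h1 : (n + 1 + ∑ α ∈ P, k α : ℝ) • N = Q + reflectionSum P k (n + 1) N := by
    rw [← h]; abel
  have h2 := congrArg norm h1
  rw [norm_smul, Real.norm_of_nonneg (by positivity)] at h2
  have h3 := norm_add_le Q (reflectionSum P k (n + 1) N)
  have h4 := (reflectionSum P k (n + 1)).le_of_opNorm_le (norm_reflectionSum_le hk (n + 1)) N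
  linarith

theorem norm_kernelCoeff_le (hk : ∀ α ∈ P, 0 ≤ k α) (y : V) (n : ℕ) :
    ‖kernelCoeff P k y n‖ ≤ ‖y‖ ^ n / n.factorial := by
  induction n with
  | zero => simp [kernelCoeff]
  | succ n ih =>
    have h : ((n : ℝ) + 1) * ‖kernelCoeff P k y (n + 1)‖ ≤ ‖y‖ * ‖kernelCoeff P k y n‖ := by
      refine (norm_radialInverse_le hk n _).trans_eq ?_
      rw [LinearIsometryEquiv.norm_map, ContinuousLinearMap.norm_smulRight_apply, innerSL_apply_norm]
    rw [Nat.factorial_succ, Nat.cast_mul, Nat.cast_succ, le_div_iff₀ (by positivity), ← mul_assoc,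
      mul_comm ‖_‖]
    rw [le_div_iff₀ (by positivity)] at ih
    calc _ ≤ ‖y‖ * ‖kernelCoeff P k y n‖ * n.factorial := by gcongr
      _ = ‖y‖ * (‖kernelCoeff P k y n‖ * n.factorial) := by ring
      _ ≤ ‖y‖ * ‖y‖ ^ n := by gcongr
      _ = _ := by ring

theorem continuous_kernelCoeff (n : ℕ) : Continuous fun y => kernelCoeff P k y n := by
  induction n with
  | zero => exact continuous_const
  | succ n ih =>
    refine (radialInverse P k n).continuous.comp
      ((LinearIsometryEquiv.continuous _).comp ?_)
    exact ((ContinuousLinearMap.smulRightL ℝ V (V [×n]→L[ℝ] ℝ)).continuous₂).comp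
      ((innerSL ℝ).continuous.prodMk ih)

theorem kernelCoeff_smul (t : ℝ) (y : V) (n : ℕ) :
    kernelCoeff P k (t • y) n = t ^ n • kernelCoeff P k y n := by
  induction n with
  | zero => simp [kernelCoeff]
  | succ n ih =>
    have h : (innerSL ℝ (t • y)).smulRight (kernelCoeff P k (t • y) n) =
        t ^ (n + 1) • (innerSL ℝ y).smulRight (kernelCoeff P k y n) := by
      ext v
      simp [ih]
      ring
    simp only [kernelCoeff]
    rw [h, map_smul, map_smul]

/-- The recursion, restricted to the diagonal; the forms themselves need not be symmetric. This is
the hypothesis that `dunklOp_eq_of_radial` asks for. -/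
theorem kernelCoeff_radial (hk : ∀ α ∈ P, 0 ≤ k α) (y : V) (n : ℕ) (x : V) :
    (n + 1) * kernelCoeff P k y (n + 1) (fun _ => x) + ∑ α ∈ P, k α *
      (kernelCoeff P k y (n + 1) (fun _ => x) - kernelCoeff P k y (n + 1) fun _ => rootReflection α x)
      = ⟪x, y⟫ * kernelCoeff P k y n fun _ => x := by
  have h := congrArg (fun M => M fun _ => x) (radialInverse_spec hk n
    ((continuousMultilinearCurryLeftEquiv ℝ (fun _ : Fin (n + 1) => V) ℝ).symm
        ((innerSL ℝ y).smulRight (kernelCoeff P k y n))))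
  simp only [sub_apply, smul_apply, reflectionSum_apply,
    continuousMultilinearCurryLeftEquiv_symm_apply, ContinuousLinearMap.smulRight_apply,
    innerSL_apply_apply, smul_eq_mul] at h
  rw [real_inner_comm y x]
  refine Eq.trans ?_ h
  simp only [mul_sub, Finset.sum_sub_distrib, ← Finset.sum_mul, kernelCoeff]
  ring

theorem dunklOp_kernelCoeff_zero (ξ y : V) :
    dunklOp P k ξ (fun x => kernelCoeff P k y 0 fun _ => x) = 0 :=
  dunklOp_const ξ 1

theorem dunklOp_kernelCoeff_succ [FiniteDimensional ℝ V] (hP : IsReflectionWeight P k) (y : V)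
    (n : ℕ) : ∀ ξ, dunklOp P k ξ (fun x => kernelCoeff P k y (n + 1) fun _ => x) =
      ⟪ξ, y⟫ • fun x => kernelCoeff P k y n fun _ => x := by
  have key : ∀ n E', (∀ ξ, dunklOp P k ξ (fun x => kernelCoeff P k y n fun _ => x) = ⟪ξ, y⟫ • E') →
      ∀ ξ, dunklOp P k ξ (fun x => kernelCoeff P k y (n + 1) fun _ => x) =
        ⟪ξ, y⟫ • fun x => kernelCoeff P k y n fun _ => x := fun n E' h =>
    dunklOp_eq_of_radial hP y (diag_mem_linearForms_pow _) (diag_mem_linearForms_pow _) h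
      (kernelCoeff_radial hP.nonneg y n)
  induction n with
  | zero => exact key 0 0 fun ξ => by rw [dunklOp_kernelCoeff_zero, smul_zero]
  | succ n ih => exact key (n + 1) _ ih

end Coefficients

/-! ### Existence and uniqueness of the Dunkl kernel -/

section Kernel

/-- The Taylor series of the Dunkl kernel `x ↦ D_k(x, y)` at the origin. -/
def kernelSeries (P : Finset V) (k : V → ℝ) (y : V) : FormalMultilinearSeries ℝ V ℝ :=
  fun n => kernelCoeff P k y n

variable {P : Finset V} {k : V → ℝ}

theorem radius_kernelSeries (hk : ∀ α ∈ P, 0 ≤ k α) (y : V) : (kernelSeries P k y).radius = ⊤ := by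
  refine FormalMultilinearSeries.radius_eq_top_of_summable_norm _ fun r => ?_
  refine .of_nonneg_of_le (fun n => by positivity) (fun n => ?_)
    (Real.summable_pow_div_factorial (‖y‖ * r))
  calc _ ≤ ‖y‖ ^ n / n.factorial * (r : ℝ) ^ n := by
        gcongr; exact norm_kernelCoeff_le hk y n
    _ = _ := by rw [mul_pow]; ring

theorem isDunklEigenfunction_kernelSeries [FiniteDimensional ℝ V] (hP : IsReflectionWeight P k)
    (y : V) : IsDunklEigenfunction P k y (kernelSeries P k y).sum where
  analytic := analyticOnNhd_sum (radius_kernelSeries hP.nonneg y)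
  map_zero := by
    have h := hasSum_diag (radius_kernelSeries hP.nonneg y) 0
    refine h.unique ?_
    have h0 : (kernelSeries P k y 0 fun _ => 0) = (1 : ℝ) := rfl
    rw [← h0]
    refine hasSum_single 0 fun n hn => ?_
    have : Nonempty (Fin n) := ⟨⟨0, Nat.pos_of_ne_zero hn⟩⟩
    exact (kernelSeries P k y n).map_coord_zero (Classical.arbitrary _) rfl
  eigen ξ x := by
    have hr := radius_kernelSeries hP.nonneg y
    refine (hasSum_dunklOp_diag hr ξ x).unique ?_
    -- The operator kills the degree 0 term and lowers all others by one degree, so the series is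
    -- shifted by one.
    rw [← hasSum_nat_add_iff' 1]
    simp only [Finset.range_one, Finset.sum_singleton, kernelSeries, dunklOp_kernelCoeff_zero,
      dunklOp_kernelCoeff_succ hP, Pi.zero_apply, sub_zero]
    exact (hasSum_diag hr x).mul_left _

/-- An eigenfunction of the Dunkl operators vanishing at the origin vanishes: the sum of its
squares over an orbit satisfies a Gronwall inequality along rays. -/
theorem eq_zero_of_dunklOp_eq (hP : IsReflectionWeight P k) (G : Subgroup (V ≃ₗᵢ[ℝ] V)) [Finite G]
    (hG : ∀ α ∈ P, rootReflection α ∈ G) (y : V) {u : V → ℝ} (hu : Differentiable ℝ u)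
    (h0 : u 0 = 0) (hT : ∀ ξ x, dunklOp P k ξ u x = ⟪ξ, y⟫ * u x) (x : V) : u x = 0 := by
  have := Fintype.ofFinite G
  let z : G → ℝ → V := fun w t => t • (w : V ≃ₗᵢ[ℝ] V) x
  let F : ℝ → ℝ := fun t => ∑ w : G, u (z w t) ^ 2
  let F' : ℝ → ℝ := fun t => ∑ w : G, 2 * u (z w t) * fderiv ℝ u (z w t) ((w : V ≃ₗᵢ[ℝ] V) x)
  have hF : ∀ t, HasDerivAt F (F' t) t := by
    intro t
    refine HasDerivAt.fun_sum fun w _ => ?_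
    have h1 : HasDerivAt (z w) ((w : V ≃ₗᵢ[ℝ] V) x) t := by
      simpa using (hasDerivAt_id t).smul_const ((w : V ≃ₗᵢ[ℝ] V) x)
    have h2 := ((hu (z w t)).hasFDerivAt.comp_hasDerivAt t h1).fun_pow 2
    simpa using! h2
  let C : ℝ := 2 * (‖x‖ * ‖y‖)
  have hle : ∀ t, 0 < t → F' t ≤ C * F t := by
    intro t ht
    -- Multiplying by `t` turns the derivative along the ray into the radial derivative, where the
    -- eigenvalue equation has no denominators.
    have h1 : t * F' t = ∑ w : G, 2 * ⟪z w t, y⟫ * u (z w t) ^ 2 - ∑ α ∈ P, k α * ∑ w : G,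
        2 * (u (z w t) ^ 2 - u (z w t) * u (rootReflection α (z w t))) := by
      simp only [F', Finset.mul_sum]
      rw [Finset.sum_comm, ← Finset.sum_sub_distrib]
      refine Finset.sum_congr rfl fun w _ => ?_
      have h2 := hT (z w t) (z w t)
      rw [dunklOp_radial] at h2
      have h3 : t * fderiv ℝ u (z w t) ((w : V ≃ₗᵢ[ℝ] V) x) = fderiv ℝ u (z w t) (z w t) := by
        simp [z]
      calc _ = 2 * u (z w t) * (t * fderiv ℝ u (z w t) ((w : V ≃ₗᵢ[ℝ] V) x)) := by ring
        _ = 2 * u (z w t) * (⟪z w t, y⟫ * u (z w t) -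
              ∑ α ∈ P, k α * (u (z w t) - u (rootReflection α (z w t)))) := by rw [h3, ← h2]; ring
        _ = _ := by
          rw [mul_sub, Finset.mul_sum]
          congr 1
          · ring
          · exact Finset.sum_congr rfl fun α _ => by ring
    have h4 : 0 ≤ ∑ α ∈ P, k α * ∑ w : G,
        2 * (u (z w t) ^ 2 - u (z w t) * u (rootReflection α (z w t))) := by
      refine Finset.sum_nonneg fun α hα => mul_nonneg (hP.nonneg α hα) ?_
      -- Left multiplication by `σ_α` permutes the group. Hence the reflection terms add up to a sum
      -- of squares and enter `F'` with a favourable sign.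
      have h5 : ∑ w : G, u (rootReflection α (z w t)) ^ 2 = ∑ w : G, u (z w t) ^ 2 := by
        refine Eq.trans (Finset.sum_congr rfl fun w _ => ?_)
          (Equiv.sum_comp (Equiv.mulLeft (⟨rootReflection α, hG α hα⟩ : G)) fun w => u (z w t) ^ 2)
        simp [z]
      calc (0 : ℝ) ≤ ∑ w : G, (u (z w t) - u (rootReflection α (z w t))) ^ 2 :=
            Finset.sum_nonneg fun _ _ => sq_nonneg _
        _ = ∑ w : G, 2 * (u (z w t) ^ 2 - u (z w t) * u (rootReflection α (z w t)))
            + (∑ w : G, u (rootReflection α (z w t)) ^ 2 - ∑ w : G, u (z w t) ^ 2) := by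
          rw [← Finset.sum_sub_distrib, ← Finset.sum_add_distrib]
          exact Finset.sum_congr rfl fun _ _ => by ring
        _ = _ := by rw [h5, sub_self, add_zero]
    have h6 : ∑ w : G, 2 * ⟪z w t, y⟫ * u (z w t) ^ 2 ≤ t * (C * F t) := by
      simp only [F, Finset.mul_sum]
      refine Finset.sum_le_sum fun w _ => ?_
      have h7 : ⟪z w t, y⟫ ≤ t * (‖x‖ * ‖y‖) := by
        refine (real_inner_le_norm _ _).trans_eq ?_
        simp [z, norm_smul, abs_of_pos ht, mul_assoc]
      calc _ ≤ 2 * (t * (‖x‖ * ‖y‖)) * u (z w t) ^ 2 := by gcongr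
        _ = _ := by simp only [C]; ring
    exact le_of_mul_le_mul_left (by linarith) ht
  have hanti : AntitoneOn (fun t => F t * Real.exp (-(C * t))) (Set.Ici 0) := by
    have hd : ∀ t, HasDerivAt (fun t => F t * Real.exp (-(C * t)))
        (F' t * Real.exp (-(C * t)) + F t * (Real.exp (-(C * t)) * -(C * 1))) t := fun t =>
      (hF t).mul ((hasDerivAt_id t).const_mul C).neg.exp
    refine antitoneOn_of_deriv_nonpos (convex_Ici 0)
      (fun t _ => (hd t).continuousAt.continuousWithinAt)
      (fun t _ => (hd t).differentiableAt.differentiableWithinAt) fun t ht => ?_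
    rw [interior_Ici, Set.mem_Ioi] at ht
    rw [(hd t).deriv]
    have := mul_le_mul_of_nonneg_right (hle t ht) (Real.exp_pos (-(C * t))).le
    linarith
  have h1 := hanti (Set.mem_Ici.2 le_rfl) (Set.mem_Ici.2 zero_le_one) zero_le_one
  have hF0 : F 0 = 0 := by simp [F, z, h0]
  simp only [hF0, zero_mul] at h1
  have h2 : F 1 ≤ 0 := nonpos_of_mul_nonpos_left h1 (Real.exp_pos _)
  have h3 : u (z 1 1) ^ 2 ≤ F 1 :=
    Finset.single_le_sum (f := fun w : G => u (z w 1) ^ 2) (fun _ _ => sq_nonneg _)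
      (Finset.mem_univ 1)
  have h4 : z 1 1 = x := by simp [z]
  rw [h4] at h3
  exact pow_eq_zero_iff (two_ne_zero) |>.1 (le_antisymm (h3.trans h2) (sq_nonneg _))

/-- The series shows that the defining problem is solvable, so the chosen kernel solves it too; the
difference of the two solutions vanishes at the origin and hence everywhere. -/
theorem dunklKernel_eq_kernelSeries_sum [FiniteDimensional ℝ V] (hP : IsReflectionWeight P k)
    (G : Subgroup (V ≃ₗᵢ[ℝ] V)) [Finite G] (hG : ∀ α ∈ P, rootReflection α ∈ G) (x y : V) :
    dunklKernel P k x y = (kernelSeries P k y).sum x := by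
  have h1 := isDunklEigenfunction_kernelSeries hP y
  have h2 : IsDunklEigenfunction P k y (Classical.epsilon (IsDunklEigenfunction P k y)) :=
    Classical.epsilon_spec ⟨_, h1⟩
  have d1 : Differentiable ℝ _ := fun x => (h1.analytic x trivial).differentiableAt
  have d2 : Differentiable ℝ _ := fun x => (h2.analytic x trivial).differentiableAt
  have := eq_zero_of_dunklOp_eq hP G hG y (d2.sub d1) (by simp [h1.map_zero, h2.map_zero])
    (fun ξ x => by
      rw [dunklOp_sub ξ d2 d1]
      simp [h1.eigen, h2.eigen, mul_sub]) x
  exact sub_eq_zero.1 this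

end Kernel

/-! ### Growth, homogeneity and measurability of the kernel -/

section Bounds

variable {P : Finset V} {k : V → ℝ}

theorem abs_kernelCoeff_diag_le (hk : ∀ α ∈ P, 0 ≤ k α) (y x : V) (n : ℕ) :
    |kernelCoeff P k y n fun _ => x| ≤ (‖x‖ * ‖y‖) ^ n / n.factorial := by
  refine ((kernelCoeff P k y n).le_opNorm _).trans ?_
  rw [Finset.prod_const, Finset.card_univ, Fintype.card_fin]
  calc _ ≤ ‖y‖ ^ n / n.factorial * ‖x‖ ^ n := by gcongr; exact norm_kernelCoeff_le hk y n
    _ = _ := by rw [mul_pow]; ring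

/-- The exponential bound for the Dunkl kernel. -/
theorem abs_kernelSeries_sum_le (hk : ∀ α ∈ P, 0 ≤ k α) (y x : V) :
    |(kernelSeries P k y).sum x| ≤ Real.exp (‖x‖ * ‖y‖) := by
  have h1 := hasSum_diag (radius_kernelSeries hk y) x
  have h2 : HasSum (fun n : ℕ => (‖x‖ * ‖y‖) ^ n / n.factorial) (Real.exp (‖x‖ * ‖y‖)) := by
    have := NormedSpace.expSeries_div_hasSum_exp (‖x‖ * ‖y‖)
    rwa [← Real.exp_eq_exp_ℝ] at this
  rw [← h1.tsum_eq]
  exact tsum_of_norm_bounded (f := fun n => kernelSeries P k y n fun _ => x) h2 fun n => abs_kernelCoeff_diag_le hk y x n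

theorem kernelSeries_sum_smul (t : ℝ) (y x : V) :
    (kernelSeries P k y).sum (t • x) = (kernelSeries P k (t • y)).sum x := by
  refine tsum_congr fun n => ?_
  simp only [kernelSeries, kernelCoeff_smul, smul_apply, (kernelCoeff P k y n).map_smul_univ
    (fun _ => t) fun _ => x]
  simp

/-- Doubling the exponent buys a geometric factor, which makes series of integrals summable and lets
sum and integral be exchanged. -/
theorem pow_div_factorial_le_geometric_mul_exp (n : ℕ) {s : ℝ} (hs : 0 ≤ s) :
    s ^ n / n.factorial ≤ (1 / 2) ^ n * Real.exp (2 * s) := by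
  have h := Real.pow_div_factorial_le_exp (2 * s) (by positivity) n
  calc s ^ n / n.factorial = (1 / 2) ^ n * ((2 * s) ^ n / n.factorial) := by
        rw [mul_pow, mul_div_assoc, ← mul_assoc, ← mul_pow]; norm_num
    _ ≤ _ := by gcongr

/-- A continuous linear functional commutes with the Bochner integral of forms; this carries Dunkl
operators under the integral sign degree by degree. -/
theorem exists_dunklOp_diag (P : Finset V) (k : V → ℝ) (ξ x : V) (n : ℕ) :
    ∃ L : (V [×n]→L[ℝ] ℝ) →L[ℝ] ℝ, ∀ M, dunklOp P k ξ (fun x => M fun _ => x) x = L M := by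
  let ev : (Fin n → V) → (V [×n]→L[ℝ] ℝ) →L[ℝ] ℝ :=
    ContinuousMultilinearMap.apply ℝ (fun _ : Fin n => V) ℝ
  let D : V → (V [×n]→L[ℝ] ℝ) →L[ℝ] ℝ := fun η => ∑ i, ev (Function.update (fun _ => x) i η)
  refine ⟨D ξ + ∑ α ∈ P, (k α * ⟪α, ξ⟫) • (if ⟪α, x⟫ = 0 then (2 / ⟪α, α⟫) • D α else
    ⟪α, x⟫⁻¹ • (ev (fun _ => x) - ev fun _ => rootReflection α x)), fun M => ?_⟩
  have hD : ∀ η, D η M = fderiv ℝ (fun x => M fun _ => x) x η := by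
    intro η
    simp [D, ev, fderiv_diag_apply]
  simp only [dunklOp, add_apply, sum_apply, smul_apply, hD, smul_eq_mul]
  congr 1
  refine Finset.sum_congr rfl fun α _ => ?_
  unfold reflectionQuotient
  split_ifs with h
  · simp only [smul_apply, hD, smul_eq_mul]
  · simp only [smul_apply, sub_apply, smul_eq_mul, ev, ContinuousMultilinearMap.apply_apply]
    ring

theorem stronglyMeasurable_kernelSeries_sum [MeasurableSpace V] [BorelSpace V]
    (hk : ∀ α ∈ P, 0 ≤ k α) (x : V) :
    StronglyMeasurable fun y => (kernelSeries P k y).sum x := by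
  refine stronglyMeasurable_of_tendsto Filter.atTop
    (f := fun N y => ∑ n ∈ Finset.range N, kernelCoeff P k y n fun _ => x) (fun N => ?_)
    (tendsto_pi_nhds.2 fun y => (hasSum_diag (radius_kernelSeries hk y) x).tendsto_sum_nat)
  refine (continuous_finsetSum _ fun n _ => ?_).stronglyMeasurable
  exact (ContinuousMultilinearMap.apply ℝ (fun _ : Fin n => V) ℝ fun _ => x).continuous.comp
    (continuous_kernelCoeff n)

end Bounds

/-! ### The integral transform with kernel `D_k` -/

section Transform

variable [FiniteDimensional ℝ V] [MeasurableSpace V] [BorelSpace V]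

/-- Measurable functions all of whose exponential moments are finite. -/
structure HasExpMoments (h : V → ℝ) : Prop where
  aestronglyMeasurable : AEStronglyMeasurable h volume
  integrable : ∀ c : ℝ, Integrable fun y => Real.exp (c * ‖y‖) * |h y|

namespace HasExpMoments

variable {h : V → ℝ}

theorem integrable_smul (hh : HasExpMoments h) {E : Type*} [NormedAddCommGroup E] [NormedSpace ℝ E]
    {φ : V → E} (hφ : AEStronglyMeasurable φ volume) {C c : ℝ}
    (hle : ∀ y, ‖φ y‖ ≤ C * Real.exp (c * ‖y‖)) : Integrable fun y => h y • φ y := by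
  refine ((hh.integrable c).const_mul C).mono' (hh.aestronglyMeasurable.smul hφ)
    (.of_forall fun y => ?_)
  rw [norm_smul, Real.norm_eq_abs]
  calc |h y| * ‖φ y‖ ≤ |h y| * (C * Real.exp (c * ‖y‖)) := by gcongr; exact hle y
    _ = _ := by ring

theorem mul (hh : HasExpMoments h) {φ : V → ℝ} (hφ : AEStronglyMeasurable φ volume) {C c : ℝ}
    (hle : ∀ y, |φ y| ≤ C * Real.exp (c * ‖y‖)) : HasExpMoments fun y => φ y * h y where
  aestronglyMeasurable := hφ.mul hh.aestronglyMeasurable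
  integrable a := by
    refine ((hh.integrable (a + c)).const_mul C).mono'
      ((by fun_prop : Continuous fun y : V => Real.exp (a * ‖y‖)).aestronglyMeasurable.mul
        (hφ.mul hh.aestronglyMeasurable).norm) (.of_forall fun y => ?_)
    rw [Real.norm_of_nonneg (by positivity), abs_mul, add_mul, Real.exp_add]
    calc _ ≤ Real.exp (a * ‖y‖) * ((C * Real.exp (c * ‖y‖)) * |h y|) := by gcongr; exact hle y
      _ = _ := by ring

theorem inner_mul (hh : HasExpMoments h) (ξ : V) : HasExpMoments fun y => ⟪ξ, y⟫ * h y := by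
  refine hh.mul (C := ‖ξ‖) (c := 1)
    (by fun_prop : Continuous fun y : V => ⟪ξ, y⟫).aestronglyMeasurable fun y => ?_
  refine (abs_real_inner_le_norm _ _).trans ?_
  gcongr
  rw [one_mul]
  linarith [Real.add_one_le_exp ‖y‖]

end HasExpMoments

/-- The integral transform `x ↦ ∫ h(y) D_k(x, y) dy`. -/
def kernelTransform (P : Finset V) (k : V → ℝ) (h : V → ℝ) (x : V) : ℝ :=
  ∫ y, h y * (kernelSeries P k y).sum x

/-- The Taylor series of `kernelTransform P k h`. -/
def transformSeries (P : Finset V) (k : V → ℝ) (h : V → ℝ) : FormalMultilinearSeries ℝ V ℝ :=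
  fun n => ∫ y, h y • kernelCoeff P k y n

variable {P : Finset V} {k : V → ℝ} {h : V → ℝ}

theorem integrable_mul_kernelSeries_sum (hk : ∀ α ∈ P, 0 ≤ k α) (hh : HasExpMoments h) (x : V) :
    Integrable fun y => h y * (kernelSeries P k y).sum x :=
  hh.integrable_smul (stronglyMeasurable_kernelSeries_sum hk x).aestronglyMeasurable
    (C := 1) (c := ‖x‖) fun y => by simpa using abs_kernelSeries_sum_le hk y x

theorem integrable_smul_kernelCoeff (hk : ∀ α ∈ P, 0 ≤ k α) (hh : HasExpMoments h) (n : ℕ) :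
    Integrable fun y => h y • kernelCoeff P k y n :=
  hh.integrable_smul (continuous_kernelCoeff n).aestronglyMeasurable (C := 1) (c := 1) fun y => by
    simpa using (norm_kernelCoeff_le hk y n).trans
      (Real.pow_div_factorial_le_exp _ (norm_nonneg y) n)

theorem radius_transformSeries (hk : ∀ α ∈ P, 0 ≤ k α) (hh : HasExpMoments h) :
    (transformSeries P k h).radius = ⊤ := by
  refine FormalMultilinearSeries.radius_eq_top_of_summable_norm _ fun r => ?_
  have hs : Summable fun n : ℕ => (1 / 2 : ℝ) ^ n * ∫ y : V, Real.exp (2 * r * ‖y‖) * |h y| :=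
    (summable_geometric_of_lt_one (by norm_num) (by norm_num)).mul_right _
  refine .of_nonneg_of_le (fun n => by positivity) (fun n => ?_) hs
  rw [← integral_const_mul]
  calc ‖transformSeries P k h n‖ * (r : ℝ) ^ n
      ≤ (∫ y, ‖h y • kernelCoeff P k y n‖) * (r : ℝ) ^ n := by
        gcongr; exact norm_integral_le_integral_norm _
    _ = ∫ y, ‖h y • kernelCoeff P k y n‖ * (r : ℝ) ^ n := (integral_mul_const _ _).symm
    _ ≤ _ := by
        refine integral_mono ((integrable_smul_kernelCoeff hk hh n).norm.mul_const _)
          ((hh.integrable _).const_mul _) fun y => ?_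
        simp only [norm_smul, Real.norm_eq_abs]
        calc |h y| * ‖kernelCoeff P k y n‖ * (r : ℝ) ^ n
            ≤ |h y| * (‖y‖ ^ n / n.factorial) * (r : ℝ) ^ n := by
              gcongr; exact norm_kernelCoeff_le hk y n
          _ = |h y| * ((r * ‖y‖) ^ n / n.factorial) := by rw [mul_pow]; ring
          _ ≤ |h y| * ((1 / 2) ^ n * Real.exp (2 * (r * ‖y‖))) := by
              gcongr; exact pow_div_factorial_le_geometric_mul_exp n (by positivity)
          _ = _ := by rw [mul_assoc 2]; ring

theorem map_transformSeries (hk : ∀ α ∈ P, 0 ≤ k α) (hh : HasExpMoments h) (n : ℕ)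
    (L : (V [×n]→L[ℝ] ℝ) →L[ℝ] ℝ) :
    L (transformSeries P k h n) = ∫ y, h y * L (kernelCoeff P k y n) := by
  rw [transformSeries, ← L.integral_comp_comm (integrable_smul_kernelCoeff hk hh n)]
  simp

theorem transformSeries_diag (hk : ∀ α ∈ P, 0 ≤ k α) (hh : HasExpMoments h) (n : ℕ) (x : V) :
    (transformSeries P k h n fun _ => x) = ∫ y, h y * kernelCoeff P k y n fun _ => x :=
  map_transformSeries hk hh n (ContinuousMultilinearMap.apply ℝ (fun _ : Fin n => V) ℝ fun _ => x)

theorem kernelTransform_eq_sum (hk : ∀ α ∈ P, 0 ≤ k α) (hh : HasExpMoments h) :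
    kernelTransform P k h = (transformSeries P k h).sum := by
  ext x
  have hint : ∀ n, Integrable fun y => h y * kernelCoeff P k y n fun _ => x := fun n => by
    simpa using (ContinuousMultilinearMap.apply ℝ (fun _ : Fin n => V) ℝ
      fun _ => x).integrable_comp (integrable_smul_kernelCoeff hk hh n)
  have hs : Summable fun n => ∫ y, ‖h y * kernelCoeff P k y n fun _ => x‖ := by
    have hs' : Summable fun n : ℕ =>
        (1 / 2 : ℝ) ^ n * ∫ y : V, Real.exp (2 * ‖x‖ * ‖y‖) * |h y| :=
      (summable_geometric_of_lt_one (by norm_num) (by norm_num)).mul_right _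
    refine .of_nonneg_of_le (fun n => integral_nonneg fun _ => norm_nonneg _) (fun n => ?_) hs'
    rw [← integral_const_mul]
    refine integral_mono (hint n).norm ((hh.integrable _).const_mul _) fun y => ?_
    simp only [norm_mul, Real.norm_eq_abs]
    calc _ ≤ |h y| * ((1 / 2) ^ n * Real.exp (2 * (‖x‖ * ‖y‖))) := by
          gcongr
          exact (abs_kernelCoeff_diag_le hk y x n).trans
            (pow_div_factorial_le_geometric_mul_exp n (by positivity))
      _ = _ := by rw [mul_assoc 2]; ring
  have h1 := hasSum_integral_of_summable_integral_norm hint hs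
  simp only [← transformSeries_diag hk hh, tsum_mul_left] at h1
  exact h1.unique (hasSum_diag (radius_transformSeries hk hh) x)

theorem analyticOnNhd_kernelTransform (hk : ∀ α ∈ P, 0 ≤ k α) (hh : HasExpMoments h) :
    AnalyticOnNhd ℝ (kernelTransform P k h) Set.univ := by
  rw [kernelTransform_eq_sum hk hh]
  exact analyticOnNhd_sum (radius_transformSeries hk hh)

/-- The transform intertwines the Dunkl operators with multiplication by linear forms. -/
theorem dunklOp_kernelTransform (hP : IsReflectionWeight P k) (hh : HasExpMoments h) (ξ : V) :
    dunklOp P k ξ (kernelTransform P k h) = kernelTransform P k fun y => ⟪ξ, y⟫ * h y := by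
  have hk := hP.nonneg
  rw [kernelTransform_eq_sum hk hh, kernelTransform_eq_sum hk (hh.inner_mul ξ)]
  ext x
  refine (hasSum_dunklOp_diag (radius_transformSeries hk hh) ξ x).unique ?_
  have key : ∀ n, dunklOp P k ξ (fun x => transformSeries P k h n fun _ => x) x =
      ∫ y, h y * dunklOp P k ξ (fun x => kernelCoeff P k y n fun _ => x) x := by
    intro n
    obtain ⟨L, hL⟩ := exists_dunklOp_diag P k ξ x n
    simp only [hL, map_transformSeries hk hh]
  rw [← hasSum_nat_add_iff' 1]
  simp only [key, Finset.range_one, Finset.sum_singleton, dunklOp_kernelCoeff_zero,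
    dunklOp_kernelCoeff_succ hP, Pi.zero_apply, mul_zero, integral_zero, sub_zero, Pi.smul_apply,
    smul_eq_mul]
  have h2 := hasSum_diag (radius_transformSeries hk (hh.inner_mul ξ)) x
  simp only [transformSeries_diag hk (hh.inner_mul ξ)] at h2
  convert! h2 using 4
  ring

theorem dunklLaplacian_kernelTransform {m : ℕ} (b : OrthonormalBasis (Fin m) ℝ V)
    (hP : IsReflectionWeight P k) (hh : HasExpMoments h) (x : V) :
    dunklLaplacian b P k (kernelTransform P k h) x =
      ∫ y, ‖y‖ ^ 2 * (h y * (kernelSeries P k y).sum x) := by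
  simp only [dunklLaplacian, dunklOp_kernelTransform hP hh,
    dunklOp_kernelTransform hP (hh.inner_mul _)]
  unfold kernelTransform
  rw [← integral_finsetSum _ fun i _ =>
    integrable_mul_kernelSeries_sum hP.nonneg ((hh.inner_mul _).inner_mul _) x]
  refine integral_congr_ae (.of_forall fun y => ?_)
  simp only [← b.sum_sq_norm_inner_right y, Finset.sum_mul, Real.norm_eq_abs, sq_abs]
  exact Finset.sum_congr rfl fun i _ => by ring

end Transform

/-! ### Positive subsystems as reflection weights -/

section PositiveRoots

variable {R S : Finset V}

theorem mem_positiveRoots {α : V} :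
    α ∈ positiveRoots R S ↔ α ∈ R ∧ IsPositiveCombination S α := by
  simp [positiveRoots]

theorem reflection_mem (hR : IsRootSystem R) {α β : V} (hα : α ∈ R) (hβ : β ∈ R) :
    rootReflection α β ∈ R :=
  weylGroup_map_mem hR (Subgroup.subset_closure ⟨α, hα, rfl⟩) β hβ

theorem neg_mem (hR : IsRootSystem R) {α : V} (hα : α ∈ R) : -α ∈ R := by
  rw [← rootReflection_self]
  exact reflection_mem hR hα hα

/-- The simple system is extended to a basis of `V`, and the functional equal to 1 on that basis is
represented by a vector. This vector lies in the chamber and separates positive from negative roots.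
-/
theorem exists_inner_eq_one [FiniteDimensional ℝ V] (hS : IsSimpleSystem R S) :
    ∃ x : V, ∀ s ∈ S, ⟪s, x⟫ = 1 := by
  let B := Module.Basis.extend hS.linearIndepOn
  let f : V →ₗ[ℝ] ℝ := B.constr ℝ fun _ => (1 : ℝ)
  refine ⟨(InnerProductSpace.toDual ℝ V).symm (LinearMap.toContinuousLinearMap f), fun s hs => ?_⟩
  rw [real_inner_comm, InnerProductSpace.toDual_symm_apply]
  have h := B.constr_basis ℝ (fun _ => (1 : ℝ))
    ⟨s, hS.linearIndepOn.subset_extend (Set.subset_univ _) hs⟩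
  rw [Module.Basis.extend_apply_self] at h
  exact h

theorem inner_pos_of_isPositiveCombination {x α : V} (hx : ∀ s ∈ S, ⟪s, x⟫ = 1)
    (hα : IsPositiveCombination S α) (h0 : α ≠ 0) : 0 < ⟪α, x⟫ := by
  obtain ⟨c, hc, rfl⟩ := hα
  have h : ⟪∑ s ∈ S, c s • s, x⟫ = ∑ s ∈ S, c s := by
    rw [sum_inner]
    exact Finset.sum_congr rfl fun s hs => by rw [inner_smul_left, hx s hs]; simp
  rw [h]
  refine (Finset.sum_nonneg hc).lt_of_ne fun h1 => h0 ?_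
  have h2 := (Finset.sum_eq_zero_iff_of_nonneg hc).1 h1.symm
  exact Finset.sum_eq_zero fun s hs => by rw [h2 s hs, zero_smul]

theorem ne_zero_of_mem (hR : IsRootSystem R) {α : V} (hα : α ∈ R) : α ≠ 0 := fun h =>
  hR.zero_notMem (h ▸ hα)

theorem nonempty_weylChamber [FiniteDimensional ℝ V] (hR : IsRootSystem R)
    (hS : IsSimpleSystem R S) : (weylChamber (positiveRoots R S)).Nonempty := by
  obtain ⟨x, hx⟩ := exists_inner_eq_one hS
  refine ⟨x, fun α hα => ?_⟩
  rw [mem_positiveRoots] at hα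
  exact inner_pos_of_isPositiveCombination hx hα.2 (ne_zero_of_mem hR hα.1)

theorem neg_mem_positiveRoots_iff [FiniteDimensional ℝ V] (hR : IsRootSystem R)
    (hS : IsSimpleSystem R S) {α : V} (hα : α ∈ R) :
    -α ∈ positiveRoots R S ↔ α ∉ positiveRoots R S := by
  simp only [mem_positiveRoots, hα, neg_mem hR hα, true_and]
  refine ⟨fun h1 h2 => ?_, fun h => (hS.pos_or_neg α hα).resolve_left h⟩
  obtain ⟨x, hx⟩ := exists_inner_eq_one hS
  have h0 := ne_zero_of_mem hR hα
  have h3 := inner_pos_of_isPositiveCombination hx h1 (neg_ne_zero.2 h0)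
  have h4 := inner_pos_of_isPositiveCombination hx h2 h0
  rw [inner_neg_left] at h3
  linarith

theorem two_mul_sum_positiveRoots [FiniteDimensional ℝ V] (hR : IsRootSystem R)
    (hS : IsSimpleSystem R S) {ψ : V → ℝ} (hψ : ∀ α ∈ R, ψ (-α) = ψ α) :
    2 * ∑ α ∈ positiveRoots R S, ψ α = ∑ α ∈ R, ψ α := by
  classical
  have hsub : positiveRoots R S ⊆ R := fun α hα => (mem_positiveRoots.1 hα).1
  rw [← Finset.sum_sdiff hsub, two_mul]
  congr 1
  refine Finset.sum_nbij' (fun α => -α) (fun α => -α) (fun α hα => ?_) (fun α hα => ?_)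
    (fun α _ => neg_neg α) (fun α _ => neg_neg α) fun α hα => (hψ α (hsub hα)).symm
  · have h := hsub hα
    rw [Finset.mem_sdiff, neg_mem_positiveRoots_iff hR hS h, not_not]
    exact ⟨neg_mem hR h, hα⟩
  · rw [Finset.mem_sdiff] at hα
    exact (neg_mem_positiveRoots_iff hR hS hα.1).2 hα.2

/-- A weighted sum of an even function over `R_+` is half the sum over `R`, and `σ_β` permutes `R`
preserving `k`. No description of how `σ_β` acts on `R_+` is needed. -/
theorem isReflectionWeight_positiveRoots [FiniteDimensional ℝ V] (hR : IsRootSystem R)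
    (hS : IsSimpleSystem R S) {k : V → ℝ} (hk : IsMultiplicity R k) :
    IsReflectionWeight (positiveRoots R S) k where
  ne_zero α hα := ne_zero_of_mem hR (mem_positiveRoots.1 hα).1
  nonneg α hα := hk.nonneg α (mem_positiveRoots.1 hα).1
  sum_reflection β hβ φ hφ := by
    have hβ := (mem_positiveRoots.1 hβ).1
    have hinv : ∀ γ ∈ R, ∀ α ∈ R, k (rootReflection γ α) = k α := fun γ hγ α hα =>
      hk.invariant _ (Subgroup.subset_closure ⟨γ, hγ, rfl⟩) α hα
    have hkneg : ∀ α ∈ R, k (-α) = k α := fun α hα => by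
      rw [← hinv α hα α hα, rootReflection_self]
    have h1 := two_mul_sum_positiveRoots hR hS (ψ := fun α => k α * φ (rootReflection β α))
      fun α hα => by simp only [hkneg α hα, map_neg, hφ]
    have h2 := two_mul_sum_positiveRoots hR hS (ψ := fun α => k α * φ α)
      fun α hα => by simp only [hkneg α hα, hφ]
    have h3 : ∑ α ∈ R, k α * φ (rootReflection β α) = ∑ α ∈ R, k α * φ α := by
      refine Finset.sum_nbij' (fun α => rootReflection β α) (fun α => rootReflection β α)
        (fun α hα => reflection_mem hR hβ hα) (fun α hα => reflection_mem hR hβ hα)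
        (fun α _ => rootReflection_rootReflection β α)
        (fun α _ => rootReflection_rootReflection β α) fun α hα => ?_
      rw [hinv β hβ α hα]
    linarith

theorem isOpen_weylChamber (P : Finset V) : IsOpen (weylChamber P) := by
  have h : weylChamber P = ⋂ α ∈ P, {x | 0 < ⟪α, x⟫} := by ext; simp [weylChamber]
  rw [h]
  exact isOpen_biInter_finset fun α _ => isOpen_lt continuous_const (by fun_prop)

end PositiveRoots

/-! ### Gaussian weights and the Euler operator -/

section Gaussian

variable [FiniteDimensional ℝ V] [MeasurableSpace V] [BorelSpace V]

theorem integrable_exp_neg_mul_sq_norm {a : ℝ} (ha : 0 < a) :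
    Integrable fun y : V => Real.exp (-(a * ‖y‖ ^ 2)) := by
  have h := (GaussianFourier.integrable_cexp_neg_mul_sq_norm_add (V := V) (b := (a : ℂ))
    (by simpa using ha) 0 0).norm
  refine h.congr (.of_forall fun y => ?_)
  simp only [Complex.norm_exp]
  congr 1
  simp [← Complex.ofReal_pow]

theorem hasExpMoments_gaussian {a : ℝ} (ha : 0 < a) :
    HasExpMoments fun y : V => Real.exp (-(a * ‖y‖ ^ 2)) where
  aestronglyMeasurable := (by fun_prop : Continuous _).aestronglyMeasurable
  integrable c := by
    refine ((integrable_exp_neg_mul_sq_norm (V := V) (half_pos ha)).const_mul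
      (Real.exp (c ^ 2 / (2 * a)))).mono' (by fun_prop : Continuous _).aestronglyMeasurable
      (.of_forall fun y => ?_)
    rw [Real.norm_of_nonneg (by positivity), Real.abs_exp, ← Real.exp_add, ← Real.exp_add,
      Real.exp_le_exp]
    -- Completing the square: half of the Gaussian decay absorbs `e^{c‖y‖}`.
    have h : 0 ≤ a / 2 * (‖y‖ - c / a) ^ 2 := by positivity
    have h' : a / 2 * (‖y‖ - c / a) ^ 2 = c ^ 2 / (2 * a) + -(a / 2 * ‖y‖ ^ 2)
        - (c * ‖y‖ + -(a * ‖y‖ ^ 2)) := by field_simp; ring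
    linarith

variable {P : Finset V} {k : V → ℝ}

/-- The Euler operator on transforms of homogeneous functions with a Gaussian weight. -/
theorem fderiv_radial_kernelTransform (hk : ∀ α ∈ P, 0 ≤ k α) {q : V → ℝ} {N : ℕ} {C c : ℝ}
    (hq : AEStronglyMeasurable q volume) (hle : ∀ y, |q y| ≤ C * Real.exp (c * ‖y‖))
    (hhom : ∀ t : ℝ, 0 < t → ∀ y, q (t • y) = t ^ N * q y) (x : V) :
    fderiv ℝ (kernelTransform P k fun y => q y * Real.exp (-(1 / 2 * ‖y‖ ^ 2))) x x +
      (Module.finrank ℝ V + N) * kernelTransform P k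
        (fun y => q y * Real.exp (-(1 / 2 * ‖y‖ ^ 2))) x =
      ∫ y, ‖y‖ ^ 2 * (q y * Real.exp (-(1 / 2 * ‖y‖ ^ 2)) * (kernelSeries P k y).sum x) := by
  set m := Module.finrank ℝ V
  set G := kernelTransform P k fun y => q y * Real.exp (-(1 / 2 * ‖y‖ ^ 2))
  have hmom : ∀ {a : ℝ}, 0 < a → HasExpMoments fun y => q y * Real.exp (-(a * ‖y‖ ^ 2)) :=
    fun ha => (hasExpMoments_gaussian ha).mul hq hle
  have hdiff : Differentiable ℝ G := fun z =>
    (analyticOnNhd_kernelTransform hk (hmom one_half_pos) z trivial).differentiableAt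
  let I : ℝ → V → ℝ := fun u y => q y * Real.exp (-(u / 2 * ‖y‖ ^ 2)) * (kernelSeries P k y).sum x
  let I' : ℝ → V → ℝ := fun u y => -(1 / 2 * ‖y‖ ^ 2) * I u y
  have hIint : ∀ u, 0 < u → Integrable (I u) := fun u hu =>
    integrable_mul_kernelSeries_sum hk (hmom (half_pos hu)) x
  have hJ : HasDerivAt (fun u => ∫ y, I u y) (∫ y, I' 1 y) 1 := by
    -- For `u > 1/2` the weight `e^{-u|y|²/2}` is at most `e^{-|y|²/4}`, which dominates the
    -- `u`-derivative. The constant 2 below comes from `‖y‖² / 2! ≤ e^{‖y‖}`.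
    have hsq : HasExpMoments fun y => ‖y‖ ^ 2 * (q y * Real.exp (-(1 / 4 * ‖y‖ ^ 2))) := by
      refine (hmom (by norm_num)).mul (C := 2) (c := 1)
        (by fun_prop : Continuous _).aestronglyMeasurable fun y => ?_
      have := Real.pow_div_factorial_le_exp ‖y‖ (norm_nonneg y) 2
      norm_num at this
      rw [abs_of_nonneg (by positivity), one_mul]
      linarith
    refine (hasDerivAt_integral_of_dominated_loc_of_deriv_le (F := I) (F' := I')
      (Ioi_mem_nhds (show (1 / 2 : ℝ) < 1 by norm_num))
      (bound := fun y => |‖y‖ ^ 2 * (q y * Real.exp (-(1 / 4 * ‖y‖ ^ 2))) *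
        (kernelSeries P k y).sum x|)
      ?_ (hIint 1 one_pos) ?_ (.of_forall fun y u hu => ?_)
      (integrable_mul_kernelSeries_sum hk hsq x).abs (.of_forall fun y u _ => ?_)).2
    · filter_upwards [Ioi_mem_nhds (zero_lt_one (α := ℝ))] with u hu
      exact (hIint u hu).aestronglyMeasurable
    · exact ((by fun_prop : Continuous fun y : V => -(1 / 2 * ‖y‖ ^ 2)).aestronglyMeasurable).mul
        (hIint 1 one_pos).aestronglyMeasurable
    · simp only [I', I, Real.norm_eq_abs, abs_mul, abs_neg, Real.abs_exp, ← mul_assoc]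
      have hu' : (1 / 2 : ℝ) < u := hu
      gcongr ?_ * _ * ?_ * _
      · rw [abs_of_pos (by norm_num : (0 : ℝ) < 1 / 2)]
        linarith [abs_nonneg (‖y‖ ^ 2)]
      · rw [Real.exp_le_exp, neg_le_neg_iff]
        exact mul_le_mul_of_nonneg_right (by linarith) (sq_nonneg _)
    · have h1 : HasDerivAt (fun u : ℝ => -(u / 2 * ‖y‖ ^ 2)) (-(1 / 2 * ‖y‖ ^ 2)) u :=
        (((hasDerivAt_id u).div_const 2).mul_const _).neg
      have h2 := (h1.exp.const_mul (q y)).mul_const ((kernelSeries P k y).sum x)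
      refine h2.congr_deriv ?_
      simp only [I', I]
      ring
  -- Substitution `y ↦ s y`: the Jacobian gives `s ^ m`, homogeneity of `q` gives `s ^ N`, and the
  -- kernel transfers `s` to `x`.
  have hscale : ∀ s : ℝ, 0 < s → s ^ (m + N) * G (s • x) = ∫ y, I (s ^ 2)⁻¹ y := by
    intro s hs
    have h1 := Measure.integral_comp_smul (volume : Measure V) (I (s ^ 2)⁻¹) s
    have h2 : ∀ y, I (s ^ 2)⁻¹ (s • y) =
        s ^ N * (q y * Real.exp (-(1 / 2 * ‖y‖ ^ 2)) * (kernelSeries P k y).sum (s • x)) := by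
      intro y
      simp only [I, hhom s hs, norm_smul, Real.norm_of_nonneg hs.le, kernelSeries_sum_smul]
      have : (s ^ 2)⁻¹ / 2 * (s * ‖y‖) ^ 2 = 1 / 2 * ‖y‖ ^ 2 := by field_simp
      rw [this]
      ring
    simp only [h2, integral_const_mul] at h1
    rw [pow_add, mul_assoc]
    have h3 : s ^ N * G (s • x) = _ := h1
    rw [h3, smul_eq_mul, abs_of_pos (by positivity), mul_inv_cancel_left₀ (by positivity)]
  have hL : HasDerivAt (fun s : ℝ => s ^ (m + N) * G (s • x))
      ((m + N) * G x + fderiv ℝ G x x) 1 := by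
    have h1 : HasDerivAt (fun s : ℝ => s • x) x 1 := by
      simpa using (hasDerivAt_id (1 : ℝ)).smul_const x
    have h2 := (hasDerivAt_pow (m + N) (1 : ℝ)).mul
      ((hdiff ((1 : ℝ) • x)).hasFDerivAt.comp_hasDerivAt 1 h1)
    simpa using! h2
  have hR : HasDerivAt (fun s : ℝ => ∫ y, I (s ^ 2)⁻¹ y) ((∫ y, I' 1 y) * (-2)) 1 := by
    have h1 : HasDerivAt (fun s : ℝ => (s ^ 2)⁻¹) (-2) 1 := by
      simpa using! (hasDerivAt_pow 2 (1 : ℝ)).inv (by norm_num)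
    have h2 : HasDerivAt (fun u => ∫ y, I u y) (∫ y, I' 1 y) ((1 : ℝ) ^ 2)⁻¹ := by simpa using hJ
    exact h2.comp 1 h1
  have heq := hL.unique (hR.congr_of_eventuallyEq
    (Filter.eventually_of_mem (Ioi_mem_nhds zero_lt_one) hscale))
  rw [← integral_mul_const] at heq
  rw [add_comm, heq]
  refine integral_congr_ae (.of_forall fun y => ?_)
  simp only [I', I]
  ring

end Gaussian

/-! ### Symmetrization over the Weyl group and the eigenvalue equation -/

section Main

/-- The function `∏ ⟨α, y⟩` on the chamber, extended by zero. -/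
def chamberProduct (P : Finset V) : V → ℝ :=
  (weylChamber P).indicator fun y => ∏ α ∈ P, ⟪α, y⟫

theorem chamberProduct_smul (P : Finset V) {t : ℝ} (ht : 0 < t) (y : V) :
    chamberProduct P (t • y) = t ^ P.card * chamberProduct P y := by
  have h : t • y ∈ weylChamber P ↔ y ∈ weylChamber P := by
    simp only [weylChamber, Set.mem_ofPred_eq, inner_smul_right, mul_pos_iff_of_pos_left ht]
  by_cases hy : y ∈ weylChamber P
  · simp [chamberProduct, hy, h.2 hy, inner_smul_right, Finset.prod_mul_distrib]
  · simp [chamberProduct, hy, mt h.1 hy]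

theorem abs_chamberProduct_le (P : Finset V) (y : V) :
    |chamberProduct P y| ≤ (∏ α ∈ P, ‖α‖) * Real.exp (P.card * ‖y‖) := by
  have h1 : |chamberProduct P y| ≤ ∏ α ∈ P, |⟪α, y⟫| := by
    rw [← Finset.abs_prod]
    by_cases hy : y ∈ weylChamber P <;> simp [chamberProduct, hy]
  refine h1.trans ?_
  rw [Real.exp_nat_mul, ← Finset.prod_const, ← Finset.prod_mul_distrib]
  refine Finset.prod_le_prod (fun _ _ => abs_nonneg _) fun α _ => ?_
  refine (abs_real_inner_le_norm _ _).trans ?_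
  gcongr
  linarith [Real.add_one_le_exp ‖y‖]

theorem measurable_chamberProduct [MeasurableSpace V] [BorelSpace V] (P : Finset V) : Measurable (chamberProduct P) :=
  (by fun_prop : Continuous fun y : V => ∏ α ∈ P, ⟪α, y⟫).measurable.indicator
    (isOpen_weylChamber P).measurableSet

/-- The symmetrization of `chamberProduct P` over the Weyl group. -/
def symmetrizedProduct (R P : Finset V) [Fintype (weylGroup R)] (y : V) : ℝ :=
  ∑ w : weylGroup R, chamberProduct P ((w : V ≃ₗᵢ[ℝ] V).symm y)

theorem abs_symmetrizedProduct_le (R P : Finset V) [Fintype (weylGroup R)] (y : V) :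
    |symmetrizedProduct R P y| ≤ (Fintype.card (weylGroup R) * ∏ α ∈ P, ‖α‖) *
      Real.exp (P.card * ‖y‖) := by
  refine (Finset.abs_sum_le_sum_abs _ _).trans ?_
  refine (Finset.sum_le_card_nsmul _ _ ((∏ α ∈ P, ‖α‖) * Real.exp (P.card * ‖y‖))
    fun w _ => ?_).trans_eq (by simp [mul_assoc])
  simpa using abs_chamberProduct_le P ((w : V ≃ₗᵢ[ℝ] V).symm y)

theorem symmetrizedProduct_smul (R P : Finset V) [Fintype (weylGroup R)] {t : ℝ} (ht : 0 < t)
    (y : V) : symmetrizedProduct R P (t • y) = t ^ P.card * symmetrizedProduct R P y := by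
  simp only [symmetrizedProduct, map_smul, chamberProduct_smul P ht, Finset.mul_sum]

variable {R P : Finset V} {k : V → ℝ}

theorem indicator_integrandG [FiniteDimensional ℝ V] (hP : IsReflectionWeight P k) (hPR : P ⊆ R) [Fintype (weylGroup R)]
    (x y : V) : (weylChamber P).indicator (integrandG R P k x) y =
      ∑ w : weylGroup R, chamberProduct P y * Real.exp (-(1 / 2 * ‖y‖ ^ 2)) *
        (kernelSeries P k ((w : V ≃ₗᵢ[ℝ] V) y)).sum x := by
  have hG : ∀ α ∈ P, rootReflection α ∈ weylGroup R := fun α hα =>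
    Subgroup.subset_closure ⟨α, hPR hα, rfl⟩
  by_cases hy : y ∈ weylChamber P
  · rw [← Finset.mul_sum, Set.indicator_of_mem hy]
    simp only [integrandG, generalizedBessel, finsum_eq_sum_of_fintype, chamberProduct,
      Set.indicator_of_mem hy, dunklKernel_eq_kernelSeries_sum hP (weylGroup R) hG]
    rw [show -‖y‖ ^ 2 / 2 = -(1 / 2 * ‖y‖ ^ 2) by ring]
    ring
  · simp [chamberProduct, hy]

variable [FiniteDimensional ℝ V] [MeasurableSpace V] [BorelSpace V]

theorem integrable_chamberProduct_mul (hk : ∀ α ∈ P, 0 ≤ k α) (w : V ≃ₗᵢ[ℝ] V) (x : V) :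
    Integrable fun y => chamberProduct P y * Real.exp (-(1 / 2 * ‖y‖ ^ 2)) *
      (kernelSeries P k (w y)).sum x := by
  refine ((hasExpMoments_gaussian one_half_pos).mul
    (measurable_chamberProduct P).aestronglyMeasurable (abs_chamberProduct_le P)).integrable_smul
    (φ := fun y => (kernelSeries P k (w y)).sum x) (C := 1) (c := ‖x‖) ?_ fun y => ?_
  · exact ((stronglyMeasurable_kernelSeries_sum hk x).comp_measurable
      w.continuous.measurable).aestronglyMeasurable
  · simpa using abs_kernelSeries_sum_le hk (w y) x

theorem integrableOn_integrandG (hR : IsRootSystem R) (hP : IsReflectionWeight P k) (hPR : P ⊆ R)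
    (x : V) : IntegrableOn (integrandG R P k x) (weylChamber P) := by
  have := finite_weylGroup hR
  have := Fintype.ofFinite (weylGroup R)
  rw [← integrable_indicator_iff (isOpen_weylChamber P).measurableSet]
  refine Integrable.congr (integrable_finsetSum Finset.univ fun (w : weylGroup R) _ =>
    integrable_chamberProduct_mul hP.nonneg (w : V ≃ₗᵢ[ℝ] V) x) (.of_forall fun y => ?_)
  exact (indicator_integrandG hP hPR x y).symm

theorem aestronglyMeasurable_symmetrizedProduct (R P : Finset V) [Fintype (weylGroup R)] :
    AEStronglyMeasurable (symmetrizedProduct R P) volume :=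
  (Finset.measurable_fun_sum Finset.univ fun (w : weylGroup R) _ =>
    (measurable_chamberProduct P).comp (w : V ≃ₗᵢ[ℝ] V).symm.continuous.measurable).aestronglyMeasurable

theorem hasExpMoments_symmetrizedProduct (R P : Finset V) [Fintype (weylGroup R)] :
    HasExpMoments fun y => symmetrizedProduct R P y * Real.exp (-(1 / 2 * ‖y‖ ^ 2)) :=
  (hasExpMoments_gaussian one_half_pos).mul (aestronglyMeasurable_symmetrizedProduct R P)
    (abs_symmetrizedProduct_le R P)

/-- For each `w` the isometric substitution `z = w y` preserves Lebesgue measure and the Gaussian,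
moving `w` from the kernel to the chamber product. -/
theorem functionG_eq_kernelTransform (hP : IsReflectionWeight P k) (hPR : P ⊆ R)
    [Fintype (weylGroup R)] : functionG R P k = kernelTransform P k fun y =>
      symmetrizedProduct R P y * Real.exp (-(1 / 2 * ‖y‖ ^ 2)) := by
  ext x
  have h1 : ∀ w : weylGroup R, ∫ y, chamberProduct P y * Real.exp (-(1 / 2 * ‖y‖ ^ 2)) *
      (kernelSeries P k ((w : V ≃ₗᵢ[ℝ] V) y)).sum x =
      ∫ z, chamberProduct P ((w : V ≃ₗᵢ[ℝ] V).symm z) * Real.exp (-(1 / 2 * ‖z‖ ^ 2)) *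
        (kernelSeries P k z).sum x := by
    intro w
    refine Eq.trans ?_ ((w : V ≃ₗᵢ[ℝ] V).measurePreserving.integral_comp
      (w : V ≃ₗᵢ[ℝ] V).toHomeomorph.measurableEmbedding _)
    simp
  have hint : ∀ w : weylGroup R, Integrable fun z =>
      chamberProduct P ((w : V ≃ₗᵢ[ℝ] V).symm z) * Real.exp (-(1 / 2 * ‖z‖ ^ 2)) *
        (kernelSeries P k z).sum x := by
    intro w
    have h := (w : V ≃ₗᵢ[ℝ] V).symm.measurePreserving.integrable_comp_of_integrable
      (integrable_chamberProduct_mul hP.nonneg (w : V ≃ₗᵢ[ℝ] V) x)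
    simpa [Function.comp_def] using h
  rw [functionG, ← integral_indicator (isOpen_weylChamber P).measurableSet]
  simp only [indicator_integrandG hP hPR]
  rw [integral_finsetSum Finset.univ fun (w : weylGroup R) _ =>
    integrable_chamberProduct_mul hP.nonneg (w : V ≃ₗᵢ[ℝ] V) x]
  simp only [h1]
  rw [← integral_finsetSum _ fun w _ => hint w]
  refine integral_congr_ae (.of_forall fun y => ?_)
  simp only [symmetrizedProduct, Finset.sum_mul]

theorem contDiff_functionG (hR : IsRootSystem R) (hP : IsReflectionWeight P k) (hPR : P ⊆ R)
    {n : WithTop ℕ∞} : ContDiff ℝ n (functionG R P k) := by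
  have := finite_weylGroup hR
  have := Fintype.ofFinite (weylGroup R)
  rw [functionG_eq_kernelTransform hP hPR, ← contDiffOn_univ]
  exact (analyticOnNhd_kernelTransform hP.nonneg
    (hasExpMoments_symmetrizedProduct R P)).contDiffOn uniqueDiffOn_univ

/-- At `x = 0` every kernel value is 1, so the integrand is positive on the chamber, a nonempty open
set and hence of positive measure. -/
theorem functionG_zero_pos (hR : IsRootSystem R) (hP : IsReflectionWeight P k) (hPR : P ⊆ R)
    (hC : (weylChamber P).Nonempty) : 0 < functionG R P k 0 := by
  have := finite_weylGroup hR
  have := Fintype.ofFinite (weylGroup R)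
  have hG : ∀ α ∈ P, rootReflection α ∈ weylGroup R := fun α hα =>
    Subgroup.subset_closure ⟨α, hPR hα, rfl⟩
  have hpos : ∀ y ∈ weylChamber P, 0 < integrandG R P k 0 y := by
    intro y hy
    have h1 : generalizedBessel R P k 0 y = Fintype.card (weylGroup R) := by
      simp [generalizedBessel, finsum_eq_sum_of_fintype,
        dunklKernel_eq_kernelSeries_sum hP (weylGroup R) hG,
        (isDunklEigenfunction_kernelSeries hP _).map_zero]
    have h2 : 0 < ∏ α ∈ P, ⟪α, y⟫ := Finset.prod_pos hy
    have h3 : 0 < Fintype.card (weylGroup R) := Fintype.card_pos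
    rw [integrandG, h1]
    positivity
  have hmeas := (isOpen_weylChamber P).measurableSet
  rw [functionG, setIntegral_pos_iff_support_of_nonneg_ae
    (ae_restrict_of_forall_mem hmeas fun y hy => (hpos y hy).le)
    (integrableOn_integrandG hR hP hPR 0)]
  have hsub : weylChamber P ⊆ Function.support (integrandG R P k 0) := fun y hy => (hpos y hy).ne'
  rw [Set.inter_eq_right.2 hsub]
  exact (isOpen_weylChamber P).measure_pos _ hC

theorem neg_operatorJ_functionG {m : ℕ} (b : OrthonormalBasis (Fin m) ℝ V) (hR : IsRootSystem R)
    (hP : IsReflectionWeight P k) (hPR : P ⊆ R) (x : V) :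
    -operatorJ b P k (functionG R P k) x = (m + P.card) * functionG R P k x := by
  have := finite_weylGroup hR
  have := Fintype.ofFinite (weylGroup R)
  rw [functionG_eq_kernelTransform hP hPR]
  have h1 := fderiv_radial_kernelTransform hP.nonneg (aestronglyMeasurable_symmetrizedProduct R P)
    (abs_symmetrizedProduct_le R P) (fun t ht y => symmetrizedProduct_smul R P ht y) x
  rw [Module.finrank_eq_card_basis b.toBasis, Fintype.card_fin,
    ← dunklLaplacian_kernelTransform b hP (hasExpMoments_symmetrizedProduct R P)] at h1
  have h2 : ∀ f : V → ℝ, eulerOp b f x = fderiv ℝ f x x := by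
    intro f
    conv_rhs => rw [← b.sum_repr' x, map_sum]
    rw [b.sum_repr' x]
    simp [eulerOp]
  rw [operatorJ, h2, ← h1]
  ring

end Main

end Dunkl
end

theorem mainTheorem2 {V : Type*} [NormedAddCommGroup V] [InnerProductSpace ℝ V]
    [FiniteDimensional ℝ V] [MeasurableSpace V] [BorelSpace V]
    {m : ℕ} (b : OrthonormalBasis (Fin m) ℝ V)
    (R S : Finset V) (hR : Dunkl.IsRootSystem R) (hS : Dunkl.IsSimpleSystem R S)
    (k : V → ℝ) (hk : Dunkl.IsMultiplicity R k) :
    (∀ x : V, IntegrableOn (Dunkl.integrandG R (Dunkl.positiveRoots R S) k x)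
      (Dunkl.weylChamber (Dunkl.positiveRoots R S))) ∧
    ContDiff ℝ 2 (Dunkl.functionG R (Dunkl.positiveRoots R S) k) ∧
    Dunkl.functionG R (Dunkl.positiveRoots R S) k ≠ 0 ∧
    ∀ x : V,
      -(Dunkl.operatorJ b (Dunkl.positiveRoots R S) k
          (Dunkl.functionG R (Dunkl.positiveRoots R S) k) x) =
        ((m : ℝ) + ((Dunkl.positiveRoots R S).card : ℝ)) *
          Dunkl.functionG R (Dunkl.positiveRoots R S) k x := by
  have hP := Dunkl.isReflectionWeight_positiveRoots hR hS hk
  have hPR : Dunkl.positiveRoots R S ⊆ R := fun α hα => (Dunkl.mem_positiveRoots.1 hα).1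
  refine ⟨Dunkl.integrableOn_integrandG hR hP hPR, Dunkl.contDiff_functionG hR hP hPR, fun h => ?_,
    Dunkl.neg_operatorJ_functionG b hR hP hPR⟩
  have h1 := Dunkl.functionG_zero_pos hR hP hPR (Dunkl.nonempty_weylChamber hR hS)
  rw [h] at h1
  exact lt_irrefl _ h1
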